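/- Let $g:\{0,1,2,\dots\}\to[0,\infty)$ satisfy $g(0)>0$ and put $G(k)=\sum_{j=0}^{k}g(j)$. For integers $N,L\ge 1$ let $$\Omega_N(L)=\Bigl\{\xi\in\{0,1,2,\dots\}^{\{1,\dots,N\}}:\ \sum_{x=1}^{N}\xi(x)=L\Bigr\},$$ let $\mu_{N,L}$ be the probability measure on $\Omega_N(L)$ given by $$\mu_{N,L}(\xi)=\frac{1}{Z_{N,L}}\prod_{x=1}^{N}G(\xi(x)),\qquad Z_{N,L}=\sum_{\xi\in\Omega_N(L)}\prod_{x=1}^{N}G(\xi(x)),$$ and let $\pi_{N,L}$ be the uniform distribution on $\Omega_N(L)$. Let $(L_N)_{N\ge1}$ be a sequence of positive integers and $(a_N)_{N\ge1}$ a real sequence with $a_N\to\infty$ and $\frac{L_N}{N a_N}\to T$ as $N\to\infty$ for some $T\in(0,\infty)$. (i) Suppose that there are $\alpha\in\mathbb R$ and $c_\alpha\in(0,\infty)$ with $g(k)/k^{\alpha}\to c_\alpha$ as $k\to\infty$. Then for every finite set $A\subset\{1,2,\dots\}$ and every bounded continuous function $f:\mathbb R^{A}\to\mathbb R$, $$\lim_{N\to\infty}E^{\mu_{N,L_N}}\Bigl[f\Bigl(\bigl(\tfrac{\eta(x)}{a_N}\bigr)_{x\in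 A}\Bigr)\Bigr]=\int f\,d\mu_{\alpha,T}^{\otimes A},$$ where $\mu_{\alpha,T}$ is the probability measure on $[0,\infty)$ given by $$\mu_{\alpha,T}(dr)=\begin{cases}\dfrac{1}{\Gamma(\alpha+2)}\Bigl(\dfrac{\alpha+2}{T}\Bigr)^{\alpha+2}r^{\alpha+1}e^{-\frac{\alpha+2}{T}r}\,dr & \text{if }\alpha>-1,\\[2mm] \dfrac1T e^{-r/T}\,dr & \text{if }\alpha\le-1,\end{cases}$$ that is, the Gamma law with shape $\alpha+2$ and mean $T$ if $\alpha>-1$, and the exponential law with mean $T$ if $\alpha\le-1$. (ii) Suppose instead that $\sum_{j\ge0}g(j)<\infty$. Then for all $A$ and $f$ as in (i), $$\lim_{N\to\infty}E^{\mu_{N,L_N}}\Bigl[f\Bigl(\bigl(\tfrac{\eta(x)}{a_N}\bigr)_{x\in A}\Bigr)\Bigr]=\int f\,d\pi_T^{\otimes A},\qquad \pi_T(dr)=\frac1T e^{-r/T}\,dr\ \text{ on }[0,\infty).$$ (iii) In particular, for all $A$ and $f$ as in (i), $$\lim_{N\to\infty}E^{\pi_{N,L_N}}\Bigl[f\Bigl(\bigl(\tfrac{\eta(x)}{a_N}\bigr)_{x\in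 A}\Bigr)\Bigr]=\int f\,d\pi_T^{\otimes A}.$$ (The expectations are defined for all $N\ge\max A$.) -/

import Mathlib

open MeasureTheory ProbabilityTheory Filter Topology

noncomputable section

namespace MoneyExchange

/-- The set of agents `Λ_N = {1, …, N}`. -/
def agents (N : ℕ) : Finset ℕ := Finset.Icc 1 N

/-- The configuration space `Ω(A, L)`: all `ξ : A → ℤ₊` with `∑ x, ξ x = L`. -/
def configs (A : Finset ℕ) (L : ℕ) : Finset (A → ℕ) := Finset.piAntidiag Finset.univ L

theorem mem_configs (A : Finset ℕ) (L : ℕ) (ξ : A → ℕ) :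
    ξ ∈ configs A L ↔ ∑ x, ξ x = L := by
  simp [configs, Finset.mem_piAntidiag]

/-- The partial sums `G k = g 0 + ⋯ + g k` of the weight function. -/
def cumWeight (g : ℕ → ℝ) (k : ℕ) : ℝ := ∑ j ∈ Finset.range (k + 1), g j

/-- The unnormalized weight `∏ x, G (ξ x)` of a configuration. -/
def configWeight (g : ℕ → ℝ) (N : ℕ) (ξ : agents N → ℕ) : ℝ := ∏ x, cumWeight g (ξ x)

/-- The normalization factor `Z_{N,L}`. -/
def partitionFn (g : ℕ → ℝ) (N L : ℕ) : ℝ :=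
  ∑ ξ ∈ configs (agents N) L, configWeight g N ξ

/-- The measure `μ_{N,L}`, supported on `Ω_N(L)`, which gives the configuration `ξ` the mass
`Z_{N,L}⁻¹ ∏ x, G (ξ x)`. -/
def stationaryMeasure (g : ℕ → ℝ) (N L : ℕ) : Measure (agents N → ℕ) :=
  ∑ ξ ∈ configs (agents N) L,
    ENNReal.ofReal (configWeight g N ξ / partitionFn g N L) • Measure.dirac ξ

/-- The measure `π_{N,L}`: the uniform distribution on `Ω_N(L)`. -/
def reshufflingMeasure (N L : ℕ) : Measure (agents N → ℕ) :=
  uniformOn (configs (agents N) L : Set (agents N → ℕ))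

/-- The coordinates in `A` of the scaled field `η / b`. Coordinates outside `{1, …, N}` are set
to `0`; for a finite `A ⊆ {1, 2, …}` there are none as soon as `N ≥ max A`. -/
def scaledField (N : ℕ) (b : ℝ) (A : Finset ℕ) (η : agents N → ℕ) : A → ℝ :=
  fun x => (if h : (x : ℕ) ∈ agents N then (η ⟨x, h⟩ : ℝ) else 0) / b

/-- The marginal `μ_{α,T}` of the limit: the Gamma law with shape `α + 2` and rate `(α + 2) / T`
if `α > -1`, and the exponential law with rate `1 / T` if `α ≤ -1`. -/
def limitMarginal (α T : ℝ) : Measure ℝ :=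
  if -1 < α then gammaMeasure (α + 2) ((α + 2) / T) else expMeasure (1 / T)

end MoneyExchange

end

/-! The measure `stationaryMeasure` is a canonical ensemble: it is the law of i.i.d. variables with
mass proportional to `G k * exp (-θ k / a)`, conditioned on their total. The proof has two halves:
these single-site laws, divided by `a`, converge to a Gamma law, and the conditioning is
asymptotically invisible in finitely many coordinates.

For the first half, if `G ⌊u * a⌋ / φ a → u ^ ρ` with a polynomial bound, dominated convergence
gives the limit density proportional to `u ^ ρ * exp (-θ u)`. Power-law `g` gives `ρ = α + 1` for `α
> -1`, and `ρ = 0` for `α = -1` (logarithmic `G`) or for summable `g` (bounded `G`). The uniform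
distribution is the case `G = 1`.

For the second half no local limit theorem is used. Let `P` be the product probability that the
total is `L`, and split most of the `N` sites into `M` blocks of the size of `A`, with `M` of order
`N`. By exchangeability all blocks have the same canonical mean of `f`. Jensen's inequality bounds
`M * t` times the difference of the canonical and product means by the logarithm of an exponential
moment, which is at most `q / P` times a product of independent block moments. Here `q` bounds the
point masses and comes from leaving one site free. The resulting error is `log (q / P) / (t * M) + 4
* C ^ 2 * t`, so `P` is needed only up to factors `exp (o(N))`.

To bound `P` below, tune the single-site mean to be slightly too small, by `d * a`. Chebyshev puts
the total in a window just below `L` with probability at least `1 / 2`. Since `G` is monotone, so is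
`Z`, and every total in the window is at most `exp (2 * d * θ * N)` times likelier than `L`. The
error becomes of order `d / t + t` for large `N`; choose `t` small, then `d` small. The factor `1 /
a` in `q` cancels the factor `a` in the window's length, so no growth rate of `a` relative to `N` is
required. -/

namespace MoneyExchange

/-! ### Canonical ensemble: monotonicity, exchangeability, Jensen -/

section Canonical

variable {ι : Type*} [Fintype ι] [DecidableEq ι]

/-- The partition function of the canonical ensemble on `ι` with total `L` and weights `G`. -/
noncomputable def canonicalZ (G : ℕ → ℝ) (ι : Type*) [Fintype ι] [DecidableEq ι] (L : ℕ) : ℝ :=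
  ∑ ξ ∈ Finset.piAntidiag (Finset.univ : Finset ι) L, ∏ x, G (ξ x)

/-- The expectation of `F` under the canonical ensemble with total `L` and weights `G`. -/
noncomputable def canonicalMean (G : ℕ → ℝ) (L : ℕ) (F : (ι → ℕ) → ℝ) : ℝ :=
  ∑ ξ ∈ Finset.piAntidiag (Finset.univ : Finset ι) L, (∏ x, G (ξ x)) / canonicalZ G ι L * F ξ

/-- Putting the extra `L - L'` units on one fixed site is injective on configurations and, as `G` is
monotone, does not lower the weight. This replaces a local limit theorem in the lower bound for the
probability of the total. -/
theorem canonicalZ_mono [Nonempty ι] {G : ℕ → ℝ} (hG : ∀ k, 0 < G k) (hmono : Monotone G) :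
    Monotone (canonicalZ G ι) := by
  intro L' L h
  obtain ⟨x₀⟩ := ‹Nonempty ι›
  let T : (ι → ℕ) → (ι → ℕ) := fun ξ => ξ + Pi.single x₀ (L - L')
  have hT : Function.Injective T := fun ξ ζ h => by simpa [T] using h
  unfold canonicalZ
  calc ∑ ξ ∈ Finset.piAntidiag (Finset.univ : Finset ι) L', ∏ x, G (ξ x)
      ≤ ∑ ξ ∈ Finset.piAntidiag (Finset.univ : Finset ι) L', ∏ x, G (T ξ x) := by
        refine Finset.sum_le_sum fun ξ _ => Finset.prod_le_prod (fun x _ => (hG _).le) fun x _ => ?_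
        exact hmono (by simp [T])
    _ = ∑ ξ ∈ (Finset.piAntidiag (Finset.univ : Finset ι) L').image T, ∏ x, G (ξ x) := by
        rw [Finset.sum_image fun _ _ _ _ h => hT h]
    _ ≤ _ := by
        refine Finset.sum_le_sum_of_subset_of_nonneg ?_ fun ξ _ _ =>
          Finset.prod_nonneg fun x _ => (hG _).le
        intro ξ hξ
        obtain ⟨ζ, hζ, rfl⟩ := Finset.mem_image.1 hξ
        have := (Finset.mem_piAntidiag.1 hζ).1
        simp [Finset.mem_piAntidiag, T, Finset.sum_add_distrib, this, h]

theorem canonicalZ_pos [Nonempty ι] {G : ℕ → ℝ} (hG : ∀ k, 0 < G k) (L : ℕ) :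
    0 < canonicalZ G ι L := by
  obtain ⟨x₀⟩ := ‹Nonempty ι›
  refine Finset.sum_pos (fun ξ _ => Finset.prod_pos fun x _ => hG _) ⟨Pi.single x₀ L, ?_⟩
  simp [Finset.mem_piAntidiag]

theorem canonicalMean_comp_perm (G : ℕ → ℝ) (L : ℕ) (F : (ι → ℕ) → ℝ) (σ : Equiv.Perm ι) :
    canonicalMean G L (fun ξ => F (ξ ∘ σ)) = canonicalMean G L F := by
  unfold canonicalMean
  refine Finset.sum_equiv (Equiv.arrowCongr σ.symm (Equiv.refl ℕ)) (fun ξ => ?_) fun ξ _ => ?_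
  · simp only [Finset.mem_piAntidiag, Finset.mem_univ, implies_true, and_true]
    rw [← Equiv.sum_comp σ ξ]
    rfl
  · rw [← Equiv.prod_comp σ fun x => G (ξ x)]
    rfl

/-- Exchangeability: any two embeddings of a finite set differ by a permutation of the sites, which
preserves the weights. It makes all blocks equivalent to the coordinates of interest. -/
theorem canonicalMean_comp_embedding {A : Type*} [Fintype A] (G : ℕ → ℝ) (L : ℕ)
    (f : (A → ℕ) → ℝ) (e e' : A ↪ ι) :
    canonicalMean G L (fun ξ => f (ξ ∘ e)) = canonicalMean G L (fun ξ => f (ξ ∘ e')) := by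
  obtain ⟨σ, hσ⟩ : ∃ σ : Equiv.Perm ι, ∀ i, σ (e' i) = e i := by
    obtain ⟨σ, hσ⟩ := Equiv.Perm.exists_smul_eq_embedding e' e
    exact ⟨σ, fun i => DFunLike.congr_fun hσ i⟩
  rw [← canonicalMean_comp_perm G L (fun ξ => f (ξ ∘ e')) σ]
  congr 1
  ext ξ
  congr 1
  ext i
  simp [hσ]

theorem canonicalMean_const [Nonempty ι] {G : ℕ → ℝ} (hG : ∀ k, 0 < G k) (L : ℕ) (a : ℝ) :
    canonicalMean (ι := ι) G L (fun _ => a) = a := by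
  unfold canonicalMean
  rw [← Finset.sum_mul, ← Finset.sum_div]
  change canonicalZ G ι L / canonicalZ G ι L * a = a
  rw [div_self (canonicalZ_pos hG L).ne', one_mul]

theorem canonicalMean_add (G : ℕ → ℝ) (L : ℕ) (F F' : (ι → ℕ) → ℝ) :
    canonicalMean G L (fun ξ => F ξ + F' ξ) = canonicalMean G L F + canonicalMean G L F' := by
  simp [canonicalMean, mul_add, Finset.sum_add_distrib]

theorem canonicalMean_const_mul (G : ℕ → ℝ) (L : ℕ) (a : ℝ) (F : (ι → ℕ) → ℝ) :
    canonicalMean G L (fun ξ => a * F ξ) = a * canonicalMean G L F := by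
  simp only [canonicalMean, Finset.mul_sum]
  exact Finset.sum_congr rfl fun _ _ => by ring

theorem canonicalMean_sum {κ : Type*} (s : Finset κ) (G : ℕ → ℝ) (L : ℕ)
    (F : κ → (ι → ℕ) → ℝ) :
    canonicalMean G L (fun ξ => ∑ b ∈ s, F b ξ) = ∑ b ∈ s, canonicalMean G L (F b) := by
  simp only [canonicalMean, Finset.mul_sum]
  exact Finset.sum_comm

theorem canonicalMean_mono [Nonempty ι] {G : ℕ → ℝ} (hG : ∀ k, 0 < G k) (L : ℕ)
    {F F' : (ι → ℕ) → ℝ} (h : ∀ ξ, F ξ ≤ F' ξ) : canonicalMean G L F ≤ canonicalMean G L F' := by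
  refine Finset.sum_le_sum fun ξ _ => mul_le_mul_of_nonneg_left (h ξ) ?_
  exact div_nonneg (Finset.prod_nonneg fun x _ => (hG _).le) (canonicalZ_pos hG L).le

/-- Jensen's inequality for the exponential function under the canonical ensemble. -/
theorem canonicalMean_le_log [Nonempty ι] {G : ℕ → ℝ} (hG : ∀ k, 0 < G k) (L : ℕ)
    (F : (ι → ℕ) → ℝ) {B : ℝ} (hB : canonicalMean G L (fun ξ => Real.exp (F ξ)) ≤ B) :
    canonicalMean G L F ≤ Real.log B := by
  set E := canonicalMean G L (fun ξ => Real.exp (F ξ)) with hE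
  have hEpos : 0 < E := by
    refine Finset.sum_pos (fun ξ _ => mul_pos (div_pos (Finset.prod_pos fun x _ => hG _)
      (canonicalZ_pos hG L)) (Real.exp_pos _)) ?_
    obtain ⟨x₀⟩ := ‹Nonempty ι›
    exact ⟨Pi.single x₀ L, by simp [Finset.mem_piAntidiag]⟩
  refine le_trans ?_ (Real.log_le_log hEpos hB)
  -- The tangent line of `exp` at `log E` lies below its graph; averaging that inequality is Jensen.
  have h1 : canonicalMean G L F ≤
      canonicalMean G L (fun ξ => (Real.log E - 1) + E⁻¹ * Real.exp (F ξ)) := by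
    refine canonicalMean_mono hG L fun ξ => ?_
    have := Real.add_one_le_exp (F ξ - Real.log E)
    rw [Real.exp_sub, Real.exp_log hEpos, div_eq_inv_mul] at this
    linarith
  rw [canonicalMean_add, canonicalMean_const hG, canonicalMean_const_mul, ← hE,
    inv_mul_cancel₀ hEpos.ne'] at h1
  linarith

end Canonical

/-! ### Product measures and conditioning on the total -/

section GrandCanonical

variable {ι : Type*} [Fintype ι] [DecidableEq ι]

omit [DecidableEq ι] in
theorem measureReal_pi_singleton (ν : Measure ℕ) [IsProbabilityMeasure ν] (ξ : ι → ℕ) :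
    (Measure.pi fun _ : ι => ν).real {ξ} = ∏ x, ν.real {ξ x} := by
  simp [Measure.real, Measure.pi_singleton, ENNReal.toReal_prod]

omit [DecidableEq ι] in
theorem prod_measureReal_singleton {ν : Measure ℕ} {G : ℕ → ℝ} {c r : ℝ}
    (hν : ∀ k, ν.real {k} = c * G k * r ^ k) {L : ℕ} {ξ : ι → ℕ} (hξ : ∑ x, ξ x = L) :
    ∏ x, ν.real {ξ x} = c ^ Fintype.card ι * r ^ L * ∏ x, G (ξ x) := by
  simp only [hν, Finset.prod_mul_distrib, Finset.prod_pow_eq_pow_sum, hξ, Finset.prod_const,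
    Finset.card_univ]
  ring

/-- On a fixed total the product mass is a constant multiple of the canonical weight; `c` and `r`
enter only through that constant. -/
theorem measureReal_sum_eq (ν : Measure ℕ) [IsProbabilityMeasure ν] {G : ℕ → ℝ} {c r : ℝ}
    (hν : ∀ k, ν.real {k} = c * G k * r ^ k) (L : ℕ) :
    (Measure.pi fun _ : ι => ν).real {ξ | ∑ x, ξ x = L} =
      c ^ Fintype.card ι * r ^ L * canonicalZ G ι L := by
  have : {ξ : ι → ℕ | ∑ x, ξ x = L} =
      ((Finset.piAntidiag (Finset.univ : Finset ι) L : Finset (ι → ℕ)) : Set (ι → ℕ)) := by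
    ext; simp [Finset.mem_piAntidiag]
  rw [this, ← sum_measureReal_singleton, canonicalZ, Finset.mul_sum]
  refine Finset.sum_congr rfl fun ξ hξ => ?_
  rw [measureReal_pi_singleton,
    prod_measureReal_singleton hν (Finset.mem_piAntidiag.1 hξ).1]

/-- By monotonicity of `Z`, raising the total from `L'` to `L` costs at most the factor `r ^ (L -
L') ≥ r ^ W`; there are at most `W + 1` totals in the window. -/
theorem measureReal_sum_mem_Icc_le [Nonempty ι] (ν : Measure ℕ) [IsProbabilityMeasure ν]
    {G : ℕ → ℝ} {c r : ℝ} (hG : ∀ k, 0 < G k) (hmono : Monotone G) (hc : 0 < c) (hr : 0 < r)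
    (hr1 : r ≤ 1) (hν : ∀ k, ν.real {k} = c * G k * r ^ k) (L W : ℕ) :
    (Measure.pi fun _ : ι => ν).real {ξ | L - W ≤ ∑ x, ξ x ∧ ∑ x, ξ x ≤ L} * r ^ W ≤
      (W + 1) * (Measure.pi fun _ : ι => ν).real {ξ | ∑ x, ξ x = L} := by
  have hsub : {ξ : ι → ℕ | L - W ≤ ∑ x, ξ x ∧ ∑ x, ξ x ≤ L} ⊆
      ⋃ L' ∈ Finset.Icc (L - W) L, {ξ | ∑ x, ξ x = L'} := by
    intro ξ hξ
    simp only [Set.mem_iUnion]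
    exact ⟨∑ x, ξ x, Finset.mem_Icc.2 hξ, rfl⟩
  have h1 := (measureReal_mono (μ := Measure.pi fun _ : ι => ν) hsub (measure_ne_top _ _)).trans
    (measureReal_biUnion_finset_le _ _)
  have h2 : ∀ L' ∈ Finset.Icc (L - W) L,
      (Measure.pi fun _ : ι => ν).real {ξ | ∑ x, ξ x = L'} * r ^ W ≤
        (Measure.pi fun _ : ι => ν).real {ξ | ∑ x, ξ x = L} := by
    intro L' hL'
    obtain ⟨h3, h4⟩ := Finset.mem_Icc.1 hL'
    rw [measureReal_sum_eq ν hν, measureReal_sum_eq ν hν]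
    have hZ := canonicalZ_mono (ι := ι) hG hmono h4
    have hZ0 := canonicalZ_pos (ι := ι) hG L'
    have hp : r ^ L' * r ^ W ≤ r ^ L := by
      rw [← pow_add]
      exact pow_le_pow_of_le_one hr.le hr1 (by omega)
    calc c ^ Fintype.card ι * r ^ L' * canonicalZ G ι L' * r ^ W
        = c ^ Fintype.card ι * (r ^ L' * r ^ W) * canonicalZ G ι L' := by ring
      _ ≤ _ := by gcongr
  calc _ ≤ (∑ L' ∈ Finset.Icc (L - W) L,
        (Measure.pi fun _ : ι => ν).real {ξ : ι → ℕ | ∑ x, ξ x = L'}) * r ^ W := by gcongr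
    _ ≤ ∑ L' ∈ Finset.Icc (L - W) L,
        (Measure.pi fun _ : ι => ν).real {ξ : ι → ℕ | ∑ x, ξ x = L} := by
      rw [Finset.sum_mul]; exact Finset.sum_le_sum h2
    _ ≤ _ := by
      rw [Finset.sum_const, nsmul_eq_mul]
      gcongr
      rw [Nat.card_Icc]
      exact_mod_cast (by omega : L + 1 - (L - W) ≤ W + 1)

/-- Summing over the canonical configurations with one coordinate left free costs at most the
largest point mass. -/
theorem sum_piAntidiag_le (ν : Measure ℕ) [IsProbabilityMeasure ν] {q : ℝ}
    (hq : ∀ k, ν.real {k} ≤ q) (x₀ : ι) (L : ℕ) {Φ : ({x // x ≠ x₀} → ℕ) → ℝ} (hΦ : ∀ ζ, 0 ≤ Φ ζ)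
    (hint : Integrable Φ (Measure.pi fun _ => ν)) :
    ∑ ξ ∈ Finset.piAntidiag (Finset.univ : Finset ι) L,
      (∏ x, ν.real {ξ x}) * Φ (fun x => ξ x) ≤ q * ∫ ζ, Φ ζ ∂(Measure.pi fun _ => ν) := by
  have hq0 : 0 ≤ q := measureReal_nonneg.trans (hq 0)
  let R : (ι → ℕ) → ({x // x ≠ x₀} → ℕ) := fun ξ x => ξ x
  have hsplit : ∀ (ξ : ι → ℕ), ∑ x, ξ x = ξ x₀ + ∑ x : {x // x ≠ x₀}, R ξ x :=
    fun ξ => Fintype.sum_eq_add_sum_subtype_ne ξ x₀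
  -- The prescribed total recovers the coordinate at `x₀` from all the others.
  have hR : Set.InjOn R (Finset.piAntidiag (Finset.univ : Finset ι) L) := by
    intro ξ hξ ζ hζ h
    have h1 := (Finset.mem_piAntidiag.1 hξ).1
    have h2 := (Finset.mem_piAntidiag.1 hζ).1
    rw [hsplit] at h1 h2
    ext x
    by_cases hx : x = x₀
    · subst hx
      rw [h] at h1
      omega
    · exact congrFun h ⟨x, hx⟩
  calc _ ≤ ∑ ξ ∈ Finset.piAntidiag (Finset.univ : Finset ι) L,
        q * ((Measure.pi fun _ : {x // x ≠ x₀} => ν).real {R ξ} * Φ (R ξ)) := by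
        refine Finset.sum_le_sum fun ξ _ => ?_
        rw [measureReal_pi_singleton, ← mul_assoc]
        refine mul_le_mul_of_nonneg_right ?_ (hΦ _)
        rw [Fintype.prod_eq_mul_prod_subtype_ne (fun x => ν.real {ξ x}) x₀]
        exact mul_le_mul_of_nonneg_right (hq _) (Finset.prod_nonneg fun _ _ => measureReal_nonneg)
    _ = q * ∑ ζ ∈ (Finset.piAntidiag (Finset.univ : Finset ι) L).image R,
        ((Measure.pi fun _ : {x // x ≠ x₀} => ν).real {ζ} * Φ ζ) := by
        rw [Finset.sum_image hR, Finset.mul_sum]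
    _ ≤ _ := by
        refine mul_le_mul_of_nonneg_left ?_ hq0
        have := setIntegral_finset ((Finset.piAntidiag (Finset.univ : Finset ι) L).image R)
          (μ := Measure.pi fun _ : {x // x ≠ x₀} => ν) (f := Φ) hint.integrableOn
        simp only [smul_eq_mul] at this
        rw [← this]
        exact setIntegral_le_integral hint (ae_of_all _ hΦ)

omit [DecidableEq ι] in
-- Disjoint blocks of coordinates are independent: restrict the product measure to the range of `e`,
-- then curry.
theorem integral_prod_blocks {κ A : Type*} [Fintype κ] [Fintype A]
    (ν : Measure ℕ) [IsProbabilityMeasure ν] (e : κ × A ↪ ι) (F : (A → ℕ) → ℝ) :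
    ∫ ζ, ∏ b, F (fun i => ζ (e (b, i))) ∂(Measure.pi fun _ : ι => ν) =
      (∫ ζ, F ζ ∂(Measure.pi fun _ : A => ν)) ^ Fintype.card κ := by
  have h1 : (Measure.pi fun _ : ι => ν).map (fun ω (p : κ × A) => ω (e p)) =
      Measure.pi fun _ : κ × A => ν := by
    rw [← Measure.infinitePi_eq_pi, ← Measure.infinitePi_eq_pi]
    exact Measure.map_infinitePi_infinitePi_of_inj (P := fun _ : ι => ν) e.injective
  have h2 : (Measure.pi fun _ : κ × A => ν).map (MeasurableEquiv.curry κ A ℕ) =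
      Measure.pi fun _ : κ => Measure.pi fun _ : A => ν := by
    have := Measure.infinitePi_map_curry (fun (_ : κ) (_ : A) => ν)
    simpa only [Measure.infinitePi_eq_pi] using this
  rw [← integral_fintype_prod_eq_pow, ← h2, ← h1, integral_map, integral_map]
  · rfl
  · exact (measurable_of_countable _).aemeasurable
  · exact (measurable_of_countable _).aestronglyMeasurable
  · exact (measurable_of_countable _).aemeasurable
  · exact (measurable_of_countable _).aestronglyMeasurable

end GrandCanonical

/-! ### Comparison of canonical and product means -/

section Comparison

variable {ι : Type*} [Fintype ι] [DecidableEq ι]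

/-- Uses `exp x ≤ 1 + x + x ^ 2` for `|x| ≤ 1` with `|f - m| ≤ 2 * C`; the linear term integrates to
zero. -/
theorem integral_exp_centered_le {Ω : Type*} [MeasurableSpace Ω] (μ : Measure Ω)
    [IsProbabilityMeasure μ] {f : Ω → ℝ} (hf : Measurable f) {C t : ℝ} (hC : ∀ ω, |f ω| ≤ C)
    (ht : 0 < t) (htC : 2 * C * t ≤ 1) :
    ∫ ω, Real.exp (t * (f ω - ∫ ω', f ω' ∂μ)) ∂μ ≤ Real.exp (4 * C ^ 2 * t ^ 2) := by
  set m := ∫ ω', f ω' ∂μ with hm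
  have hfi : Integrable f μ := Integrable.of_bound hf.aestronglyMeasurable C (ae_of_all _ hC)
  have hmC : |m| ≤ C := by
    have := norm_integral_le_of_norm_le_const (μ := μ) (f := f) (ae_of_all μ hC)
    simpa using this
  have hbound : ∀ ω, |t * (f ω - m)| ≤ 2 * C * t := fun ω => by
    rw [abs_mul, abs_of_pos ht]
    have := abs_sub (f ω) m
    nlinarith [hC ω]
  have hle : ∀ ω, Real.exp (t * (f ω - m)) ≤ 1 + t * (f ω - m) + 4 * C ^ 2 * t ^ 2 := fun ω => by
    have h1 := Real.abs_exp_sub_one_sub_id_le ((hbound ω).trans htC)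
    have h2 := (abs_le.1 h1).2
    have h3 : (t * (f ω - m)) ^ 2 ≤ (2 * C * t) ^ 2 := sq_le_sq' (by
      linarith [(abs_le.1 (hbound ω)).1]) (abs_le.1 (hbound ω)).2
    nlinarith
  have hi2 : Integrable (fun ω => 1 + t * (f ω - m) + 4 * C ^ 2 * t ^ 2) μ :=
    ((integrable_const _).add ((hfi.sub (integrable_const _)).const_mul t)).add (integrable_const _)
  have hi1 : Integrable (fun ω => Real.exp (t * (f ω - m))) μ := by
    refine Integrable.of_bound (by fun_prop) (Real.exp 1) (ae_of_all _ fun ω => ?_)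
    rw [Real.norm_eq_abs, Real.abs_exp]
    exact Real.exp_le_exp.2 ((abs_le.1 ((hbound ω).trans htC)).2)
  have hi3 : Integrable (fun ω => 1 + t * (f ω - m)) μ :=
    (integrable_const _).add ((hfi.sub (integrable_const _)).const_mul t)
  have hi4 : Integrable (fun ω => t * (f ω - m)) μ := (hfi.sub (integrable_const _)).const_mul t
  calc _ ≤ ∫ ω, (1 + t * (f ω - m) + 4 * C ^ 2 * t ^ 2) ∂μ := integral_mono hi1 hi2 hle
    _ = 4 * C ^ 2 * t ^ 2 + 1 := by
      rw [integral_add hi3 (integrable_const _), integral_add (integrable_const _) hi4,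
        integral_const_mul, integral_sub hfi (integrable_const _)]
      simp [← hm]
      ring
    _ ≤ _ := Real.add_one_le_exp _

/-- A quantitative comparison of the canonical ensemble with the grand canonical one: the price
of conditioning on the total enters only through its logarithm per block. -/
theorem canonicalMean_le_integral_add {A κ : Type*} [Fintype A] [Fintype κ] [Nonempty κ]
    (ν : Measure ℕ) [IsProbabilityMeasure ν] {G : ℕ → ℝ} {c r q : ℝ}
    (hG : ∀ k, 0 < G k) (hc : 0 < c) (hr : 0 < r)
    (hν : ∀ k, ν.real {k} = c * G k * r ^ k) (hq : ∀ k, ν.real {k} ≤ q)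
    (e : Option (κ × A) ↪ ι) (e₀ : A ↪ ι) (L : ℕ) {f : (A → ℕ) → ℝ} {C t : ℝ}
    (hC : ∀ ζ, |f ζ| ≤ C) (ht : 0 < t) (htC : 2 * C * t ≤ 1) :
    canonicalMean G L (fun ξ => f (ξ ∘ e₀)) ≤ ∫ ζ, f ζ ∂(Measure.pi fun _ : A => ν) +
      Real.log (q / (Measure.pi fun _ : ι => ν).real {ξ | ∑ x, ξ x = L}) / (t * Fintype.card κ) +
      4 * C ^ 2 * t := by
  set x₀ := e none with hx₀
  have : Nonempty ι := ⟨x₀⟩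
  set P := (Measure.pi fun _ : ι => ν).real {ξ | ∑ x, ξ x = L} with hP
  have hPe : P = c ^ Fintype.card ι * r ^ L * canonicalZ G ι L := measureReal_sum_eq ν hν L
  have hPpos : 0 < P := by rw [hPe]; have := canonicalZ_pos (ι := ι) hG L; positivity
  have hqpos : 0 < q := lt_of_lt_of_le (by rw [hν]; have := hG 0; positivity) (hq 0)
  set m := ∫ ζ, f ζ ∂(Measure.pi fun _ : A => ν) with hm
  have hfm : Measurable f := measurable_of_countable f
  -- The blocks avoid the spare site `x₀ = e none`, so the block product is a function of the
  -- remaining coordinates and `sum_piAntidiag_le` applies.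
  let e' : κ × A ↪ {x // x ≠ x₀} :=
    ⟨fun p => ⟨e (some p), fun h => by simpa using e.injective h⟩, fun p p' h => by
      simpa using e.injective (Subtype.ext_iff.1 h)⟩
  let eb : κ → (A ↪ ι) := fun b =>
    ⟨fun i => e (some (b, i)), fun i j h => by simpa using e.injective h⟩
  let F : (A → ℕ) → ℝ := fun ζ => Real.exp (t * (f ζ - m))
  have hFle : ∀ ζ, F ζ ≤ Real.exp (t * (C - m)) := fun ζ =>
    Real.exp_le_exp.2 (by have := (abs_le.1 (hC ζ)).2; gcongr)
  have hsum : canonicalMean G L (fun ξ => ∑ b, t * (f (ξ ∘ eb b) - m)) =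
      Fintype.card κ * (t * (canonicalMean G L (fun ξ => f (ξ ∘ e₀)) - m)) := by
    rw [canonicalMean_sum]
    simp only [sub_eq_add_neg, canonicalMean_const_mul, canonicalMean_add,
      canonicalMean_const hG]
    rw [Finset.sum_congr rfl fun b _ => by rw [canonicalMean_comp_embedding G L f (eb b) e₀]]
    simp
  have hexp : canonicalMean G L (fun ξ => Real.exp (∑ b, t * (f (ξ ∘ eb b) - m))) ≤
      q / P * Real.exp (4 * C ^ 2 * t ^ 2) ^ Fintype.card κ := by
    have h1 : canonicalMean G L (fun ξ => Real.exp (∑ b, t * (f (ξ ∘ eb b) - m))) =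
        (∑ ξ ∈ Finset.piAntidiag (Finset.univ : Finset ι) L, (∏ x, ν.real {ξ x}) *
          ∏ b, F (fun i => ξ (e' (b, i)))) / P := by
      unfold canonicalMean
      rw [Finset.sum_div]
      refine Finset.sum_congr rfl fun ξ hξ => ?_
      rw [prod_measureReal_singleton hν (Finset.mem_piAntidiag.1 hξ).1, hPe]
      beta_reduce
      rw [Real.exp_sum]
      have := (canonicalZ_pos (ι := ι) hG L).ne'
      have hE : ∏ b, Real.exp (t * (f (ξ ∘ eb b) - m)) = ∏ b, F (fun i => ξ (e' (b, i))) := rfl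
      rw [hE]
      field_simp
    have hint : Integrable (fun ζ : {x // x ≠ x₀} → ℕ => ∏ b, F (fun i => ζ (e' (b, i))))
        (Measure.pi fun _ => ν) := by
      refine Integrable.of_bound (measurable_of_countable _).aestronglyMeasurable
        (Real.exp (t * (C - m)) ^ Fintype.card κ) (ae_of_all _ fun ζ => ?_)
      rw [Real.norm_eq_abs, abs_of_nonneg (Finset.prod_nonneg fun _ _ => (Real.exp_pos _).le)]
      refine (Finset.prod_le_prod (fun _ _ => (Real.exp_pos _).le) fun b _ => hFle _).trans ?_
      simp
    have h2 := sum_piAntidiag_le ν hq x₀ L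
      (Φ := fun ζ => ∏ b, F (fun i => ζ (e' (b, i))))
      (fun ζ => Finset.prod_nonneg fun _ _ => (Real.exp_pos _).le) hint
    rw [integral_prod_blocks ν e' F] at h2
    rw [h1, div_mul_eq_mul_div]
    refine div_le_div_of_nonneg_right (h2.trans ?_) hPpos.le
    refine mul_le_mul_of_nonneg_left ?_ hqpos.le
    refine pow_le_pow_left₀ (integral_nonneg fun ζ => (Real.exp_pos _).le) ?_ _
    exact integral_exp_centered_le _ hfm hC ht htC
  have key := canonicalMean_le_log hG L _ hexp
  rw [hsum, Real.log_mul (by positivity) (by positivity), Real.log_pow, Real.log_exp] at key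
  have hκ : (0 : ℝ) < Fintype.card κ := by exact_mod_cast Fintype.card_pos
  have : canonicalMean G L (fun ξ => f (ξ ∘ e₀)) - m ≤
      (Real.log (q / P) + Fintype.card κ * (4 * C ^ 2 * t ^ 2)) / (t * Fintype.card κ) := by
    rw [le_div_iff₀ (by positivity)]
    linarith
  rw [add_div] at this
  have h4 : Fintype.card κ * (4 * C ^ 2 * t ^ 2) / (t * Fintype.card κ) = 4 * C ^ 2 * t := by
    field_simp
  linarith

/-- The one-sided bound for both `f` and `-f`. -/
theorem abs_canonicalMean_sub_integral_le {A κ : Type*} [Fintype A] [Fintype κ] [Nonempty κ]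
    (ν : Measure ℕ) [IsProbabilityMeasure ν] {G : ℕ → ℝ} {c r q : ℝ}
    (hG : ∀ k, 0 < G k) (hc : 0 < c) (hr : 0 < r)
    (hν : ∀ k, ν.real {k} = c * G k * r ^ k) (hq : ∀ k, ν.real {k} ≤ q)
    (e : Option (κ × A) ↪ ι) (e₀ : A ↪ ι) (L : ℕ) {f : (A → ℕ) → ℝ} {C t : ℝ}
    (hC : ∀ ζ, |f ζ| ≤ C) (ht : 0 < t) (htC : 2 * C * t ≤ 1) :
    |canonicalMean G L (fun ξ => f (ξ ∘ e₀)) - ∫ ζ, f ζ ∂(Measure.pi fun _ : A => ν)| ≤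
      Real.log (q / (Measure.pi fun _ : ι => ν).real {ξ | ∑ x, ξ x = L}) / (t * Fintype.card κ) +
      4 * C ^ 2 * t := by
  have h1 := canonicalMean_le_integral_add ν hG hc hr hν hq e e₀ L hC ht htC
  have h2 := canonicalMean_le_integral_add ν hG hc hr hν hq e e₀ L (f := fun ζ => -f ζ)
    (by simpa using hC) ht htC
  have h3 : canonicalMean G L (fun ξ => -f (ξ ∘ e₀)) =
      -canonicalMean G L (fun ξ => f (ξ ∘ e₀)) := by
    simpa using canonicalMean_const_mul G L (-1) (fun ξ => f (ξ ∘ e₀))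
  rw [h3, integral_neg] at h2
  rw [abs_le]
  constructor <;> linarith

omit [DecidableEq ι] in
-- Chebyshev for independent coordinates, with the variance bounded crudely by the second moment.
theorem measureReal_abs_sum_sub_ge_le (ν : Measure ℕ) [IsProbabilityMeasure ν]
    (h2 : MemLp (fun k : ℕ => (k : ℝ)) 2 ν) {s : ℝ} (hs : 0 < s) :
    (Measure.pi fun _ : ι => ν).real
        {ξ | s ≤ |∑ x, (ξ x : ℝ) - Fintype.card ι * ∫ k, (k : ℝ) ∂ν|} ≤
      Fintype.card ι * (∫ k, (k : ℝ) ^ 2 ∂ν) / s ^ 2 := by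
  set μ := Measure.pi fun _ : ι => ν with hμ
  have hmp : ∀ x, MeasurePreserving (fun ξ : ι → ℕ => ξ x) μ ν := fun x =>
    measurePreserving_eval (fun _ : ι => ν) x
  have hX : ∀ x : ι, MemLp (fun ξ : ι → ℕ => (ξ x : ℝ)) 2 μ := fun x =>
    h2.comp_measurePreserving (hmp x)
  have hind : iIndepFun (fun (x : ι) (ξ : ι → ℕ) => (ξ x : ℝ)) μ :=
    iIndepFun_pi (X := fun _ (k : ℕ) => (k : ℝ)) fun _ => (measurable_of_countable _).aemeasurable
  have hmean : ∀ x, ∫ ξ, (ξ x : ℝ) ∂μ = ∫ k, (k : ℝ) ∂ν := fun x => by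
    rw [← (hmp x).map_eq, integral_map (hmp x).aemeasurable
      (measurable_of_countable _).aestronglyMeasurable]
  have hsq : ∀ x, ∫ ξ, (ξ x : ℝ) ^ 2 ∂μ = ∫ k, (k : ℝ) ^ 2 ∂ν := fun x => by
    rw [← (hmp x).map_eq, integral_map (hmp x).aemeasurable
      (measurable_of_countable _).aestronglyMeasurable]
  have hsum : MemLp (∑ x, fun ξ : ι → ℕ => (ξ x : ℝ)) 2 μ := memLp_finsetSum' _ fun x _ => hX x
  have hvar : variance (∑ x, fun ξ : ι → ℕ => (ξ x : ℝ)) μ ≤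
      Fintype.card ι * ∫ k, (k : ℝ) ^ 2 ∂ν := by
    rw [IndepFun.variance_sum (fun x _ => hX x) fun x _ y _ h => hind.indepFun h]
    calc _ ≤ ∑ x : ι, ∫ k, (k : ℝ) ^ 2 ∂ν := by
          refine Finset.sum_le_sum fun x _ => ?_
          rw [← hsq x]
          exact variance_le_expectation_sq (hX x).aestronglyMeasurable
      _ = _ := by simp
  have hm : μ[∑ x, fun ξ : ι → ℕ => (ξ x : ℝ)] = Fintype.card ι * ∫ k, (k : ℝ) ∂ν := by
    simp only [Finset.sum_apply]
    rw [integral_finsetSum _ fun x _ => (hX x).integrable (by norm_num)]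
    simp [hmean]
  have h := meas_ge_le_variance_div_sq hsum hs
  rw [hm] at h
  simp only [Finset.sum_apply] at h
  have h' := ENNReal.toReal_mono ENNReal.ofReal_ne_top h
  rw [ENNReal.toReal_ofReal (div_nonneg (variance_nonneg _ _) (sq_nonneg _))] at h'
  exact h'.trans (div_le_div_of_nonneg_right hvar (sq_nonneg _))

end Comparison

/-! ### Cost of conditioning, uniformly in the scale -/

section Asymptotic

/-- The mean `T * a` is below the density `(T + d) * a`, so the total typically lies in a window of
width about `2 * d * N * a` under `L`, and tilting across it costs at most `exp (2 * d * θ * N)`.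
The window has at most `(2 * d * N + 1) * a` points; its factor `a` cancels that of `θ / a`. -/
theorem log_div_measureReal_sum_eq_le {ι : Type*} [Fintype ι] [DecidableEq ι] [Nonempty ι]
    (ν : Measure ℕ) [IsProbabilityMeasure ν] {G : ℕ → ℝ} {c θ a T d V : ℝ} {L : ℕ}
    (hG : ∀ k, 0 < G k) (hmono : Monotone G) (hc : 0 < c) (hθ : 0 < θ) (ha : 1 ≤ a) (hd : 0 < d)
    (hν : ∀ k, ν.real {k} = c * G k * Real.exp (-(θ / a)) ^ k)
    (h2 : MemLp (fun k : ℕ => (k : ℝ)) 2 ν) (hV : ∫ k, (k : ℝ) ^ 2 ∂ν ≤ V * a ^ 2)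
    (hm : |∫ k, (k : ℝ) ∂ν - T * a| ≤ d / 4 * a)
    (hL : |(L : ℝ) - (T + d) * (Fintype.card ι * a)| ≤ d / 4 * (Fintype.card ι * a))
    (hN : 32 * V ≤ d ^ 2 * Fintype.card ι) (hN' : 4 < d * Fintype.card ι) :
    Real.log (θ / a / (Measure.pi fun _ : ι => ν).real {ξ | ∑ x, ξ x = L}) ≤
      2 * d * θ * Fintype.card ι + Real.log (2 * θ * (2 * d * Fintype.card ι + 1)) := by
  set N : ℝ := (Fintype.card ι : ℝ) with hNdef
  have hNpos : 0 < N := by rw [hNdef]; exact_mod_cast Fintype.card_pos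
  set μ := Measure.pi fun _ : ι => ν with hμ
  set P := μ.real {ξ | ∑ x, ξ x = L} with hP
  have ha0 : 0 < a := by linarith
  have hPpos : 0 < P := by
    rw [hP, hμ, measureReal_sum_eq ν hν L]
    have := canonicalZ_pos (ι := ι) hG L
    positivity
  -- The three errors of size `d / 4` put `L` minus the total between `d / 4 * (N * a)` and `7 * d /
  -- 4 * (N * a)`. The slack up to `2 * d * (N * a)` exceeds 1 by `hN'` and `ha`, which absorbs the
  -- floor.
  set W := ⌊2 * d * (N * a)⌋₊ with hW
  have hWle : (W : ℝ) ≤ 2 * d * (N * a) := Nat.floor_le (by positivity)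
  have hWlt : 2 * d * (N * a) < W + 1 := Nat.lt_floor_add_one _
  set m := ∫ k, (k : ℝ) ∂ν with hmdef
  have hbad : μ.real {ξ | d / 4 * (N * a) ≤ |∑ x, (ξ x : ℝ) - N * m|} ≤ 1 / 2 := by
    refine (measureReal_abs_sum_sub_ge_le ν h2 (by positivity)).trans ?_
    rw [div_le_iff₀ (by positivity)]
    calc N * ∫ k, (k : ℝ) ^ 2 ∂ν ≤ N * (V * a ^ 2) := by gcongr
      _ = 32 * V * (N * a ^ 2 / 32) := by ring
      _ ≤ d ^ 2 * N * (N * a ^ 2 / 32) := by gcongr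
      _ = _ := by ring
  have hgood : 1 / 2 ≤ μ.real {ξ | L - W ≤ ∑ x, ξ x ∧ ∑ x, ξ x ≤ L} := by
    have hcompl := probReal_compl_eq_one_sub (μ := μ)
      (s := {ξ | d / 4 * (N * a) ≤ |∑ x, (ξ x : ℝ) - N * m|}) (Set.to_countable _).measurableSet
    have hsub : {ξ : ι → ℕ | d / 4 * (N * a) ≤ |∑ x, (ξ x : ℝ) - N * m|}ᶜ ⊆
        {ξ | L - W ≤ ∑ x, ξ x ∧ ∑ x, ξ x ≤ L} := by
      intro ξ hξ
      simp only [Set.mem_compl_iff, Set.mem_ofPred_eq, not_le] at hξ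
      obtain ⟨h3, h4⟩ := abs_lt.1 hξ
      obtain ⟨h5, h6⟩ := abs_le.1 hL
      obtain ⟨h7, h8⟩ := abs_le.1 hm
      have h9 : N * m ≤ N * (T * a + d / 4 * a) := by gcongr; linarith
      have h10 : N * (T * a - d / 4 * a) ≤ N * m := by gcongr; linarith
      have h11 : 4 < d * N * a := by nlinarith
      constructor
      · rw [tsub_le_iff_right]
        have : (L : ℝ) ≤ (∑ x, ξ x : ℕ) + W := by push_cast; nlinarith
        exact_mod_cast this
      · have : ((∑ x, ξ x : ℕ) : ℝ) ≤ L := by push_cast; nlinarith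
        exact_mod_cast this
    have := measureReal_mono (μ := μ) hsub
    linarith
  have hwin := measureReal_sum_mem_Icc_le (ι := ι) ν hG hmono hc (Real.exp_pos _)
    (Real.exp_le_one_iff.2 (by have := div_pos hθ ha0; linarith)) hν L W
  rw [← Real.exp_nat_mul] at hwin
  have hPlow : Real.exp (-(2 * d * θ * N)) ≤ 2 * (2 * d * N + 1) * a * P := by
    have h1 : Real.exp (-(2 * d * θ * N)) ≤ Real.exp (W * -(θ / a)) := by
      refine Real.exp_le_exp.2 ?_
      have : W * (θ / a) ≤ 2 * d * (N * a) * (θ / a) := by gcongr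
      have h12 : 2 * d * (N * a) * (θ / a) = 2 * d * θ * N := by field_simp
      linarith
    have h2 : (W + 1 : ℝ) ≤ (2 * d * N + 1) * a := by nlinarith
    have h3 : 1 / 2 * Real.exp (W * -(θ / a)) ≤ (W + 1) * P :=
      (mul_le_mul_of_nonneg_right hgood (Real.exp_pos _).le).trans hwin
    have h4 : (W + 1) * P ≤ (2 * d * N + 1) * a * P := by gcongr
    linarith
  have hkey : θ / a / P ≤ Real.exp (2 * d * θ * N) * (2 * θ * (2 * d * N + 1)) := by
    rw [div_div, div_le_iff₀ (by positivity)]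
    have h1 : Real.exp (2 * d * θ * N) * Real.exp (-(2 * d * θ * N)) = 1 := by
      rw [← Real.exp_add]; simp
    calc θ = θ * (Real.exp (2 * d * θ * N) * Real.exp (-(2 * d * θ * N))) := by rw [h1, mul_one]
      _ ≤ θ * (Real.exp (2 * d * θ * N) * (2 * (2 * d * N + 1) * a * P)) := by gcongr
      _ = _ := by ring
  refine (Real.log_le_log (by positivity) hkey).trans ?_
  rw [Real.log_mul (by positivity) (by positivity), Real.log_exp]

theorem card_agents (N : ℕ) : Fintype.card (agents N) = N := by
  rw [Fintype.card_coe, agents, Nat.card_Icc, Nat.add_sub_cancel]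

theorem tendsto_log_linear_div (b b' : ℝ) (hb : 0 < b) :
    Tendsto (fun N : ℕ => Real.log (b * N + b') / N) atTop (𝓝 0) := by
  have h1 : Tendsto (fun x : ℝ => Real.log x / (b⁻¹ * x + -(b⁻¹ * b'))) atTop (𝓝 0) := by
    have := Real.tendsto_pow_log_div_mul_add_atTop b⁻¹ (-(b⁻¹ * b')) 1 (by positivity)
    simpa using this
  have h2 : Tendsto (fun N : ℕ => b * (N : ℝ) + b') atTop atTop :=
    tendsto_atTop_add_const_right _ _ (tendsto_natCast_atTop_atTop.const_mul_atTop hb)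
  refine (h1.comp h2).congr fun N => ?_
  simp only [Function.comp]
  congr 1
  field_simp
  ring

theorem exists_block_embedding (A : Type*) [Fintype A] {N M : ℕ} (hM : M * Fintype.card A + 1 ≤ N) :
    Nonempty (Option (Fin M × A) ↪ agents N) := by
  refine Function.Embedding.nonempty_of_card_le ?_
  rw [card_agents]
  simpa using hM

/-- Comparison of the canonical ensembles with grand canonical ones whose mean is too small by
`d`. -/
theorem eventually_abs_canonicalMean_sub_integral_le {A : Type*} [Fintype A]
    {G : ℕ → ℝ} (hG : ∀ k, 0 < G k) (hmono : Monotone G) {θ T d V C t : ℝ} (hθ : 0 < θ)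
    (hd : 0 < d) (ht : 0 < t) (htC : 2 * C * t ≤ 1)
    {L : ℕ → ℕ} {a : ℕ → ℝ} (ha : Tendsto a atTop atTop)
    (hLa : Tendsto (fun N : ℕ => (L N : ℝ) / ((N : ℝ) * a N)) atTop (𝓝 (T + d)))
    {ν : ℝ → Measure ℕ} {c : ℝ → ℝ}
    (hprob : ∀ᶠ b in atTop, IsProbabilityMeasure (ν b)) (hc : ∀ᶠ b in atTop, 0 < c b)
    (hν : ∀ᶠ b in atTop, ∀ k, (ν b).real {k} = c b * G k * Real.exp (-(θ / b)) ^ k)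
    (hq : ∀ᶠ b in atTop, ∀ k, (ν b).real {k} ≤ θ / b)
    (h2 : ∀ᶠ b in atTop, MemLp (fun k : ℕ => (k : ℝ)) 2 (ν b))
    (hm : Tendsto (fun b => ∫ k : ℕ, (k : ℝ) / b ∂(ν b)) atTop (𝓝 T))
    (hV : Tendsto (fun b => ∫ k : ℕ, ((k : ℝ) / b) ^ 2 ∂(ν b)) atTop (𝓝 V)) :
    ∀ᶠ N in atTop, ∀ (e₀ : A ↪ agents N) (f : (A → ℕ) → ℝ), (∀ ζ, |f ζ| ≤ C) →
      |canonicalMean G (L N) (fun ξ => f (ξ ∘ e₀)) -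
        ∫ ζ, f ζ ∂(Measure.pi fun _ : A => ν (a N))| ≤
      6 * (Fintype.card A + 1) * d * θ / t + 4 * C ^ 2 * t := by
  set n := Fintype.card A with hn
  have hlog : ∀ᶠ N : ℕ in atTop,
      Real.log (2 * θ * (2 * d * N + 1)) / N ≤ d * θ := by
    have := tendsto_log_linear_div (2 * θ * (2 * d)) (2 * θ) (by positivity)
    filter_upwards [this.eventually_le_const (show (0 : ℝ) < d * θ by positivity)] with N hN
    rwa [show 2 * θ * (2 * d * N + 1) = 2 * θ * (2 * d) * N + 2 * θ by ring]
  have hL' : ∀ᶠ N : ℕ in atTop, |(L N : ℝ) / ((N : ℝ) * a N) - (T + d)| ≤ d / 4 := by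
    filter_upwards [Metric.tendsto_nhds.1 hLa (d / 4) (by positivity)] with N hN
    rw [Real.dist_eq] at hN
    exact hN.le
  have hm' : ∀ᶠ b in atTop, |∫ k : ℕ, (k : ℝ) / b ∂(ν b) - T| ≤ d / 4 := by
    filter_upwards [Metric.tendsto_nhds.1 hm (d / 4) (by positivity)] with b hb
    rw [Real.dist_eq] at hb
    exact hb.le
  have hV' : ∀ᶠ b in atTop, ∫ k : ℕ, ((k : ℝ) / b) ^ 2 ∂(ν b) ≤ V + 1 :=
    hV.eventually_le_const (by linarith)
  have hlin : Tendsto (fun N : ℕ => d * (N : ℝ)) atTop atTop :=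
    tendsto_natCast_atTop_atTop.const_mul_atTop hd
  have hlin2 : Tendsto (fun N : ℕ => d ^ 2 * (N : ℝ)) atTop atTop :=
    tendsto_natCast_atTop_atTop.const_mul_atTop (by positivity)
  filter_upwards [hlog, hL', ha.eventually hm', ha.eventually hV', ha.eventually hprob,
    ha.eventually hc, ha.eventually hν, ha.eventually hq, ha.eventually h2,
    ha.eventually_ge_atTop 1, eventually_ge_atTop (2 * (n + 1)), hlin.eventually_gt_atTop 4,
    hlin2.eventually_ge_atTop (32 * (V + 1))] with N hlog hL hm hV hprob hc hν hq h2 ha1 hN h4 h32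
  intro e₀ f hf
  have ha0 : 0 < a N := by linarith
  have hNpos : 0 < N := by omega
  have hNR : (0 : ℝ) < N := by exact_mod_cast hNpos
  -- Dividing by `n + 1` instead of `n` leaves the spare site outside the blocks and also covers
  -- empty `A`.
  set M := N / (n + 1) with hM
  have hMdiv : n * M + M + N % (n + 1) = N := by
    have := Nat.div_add_mod N (n + 1)
    rwa [← hM, add_mul, one_mul] at this
  have hMmod : N % (n + 1) < n + 1 := Nat.mod_lt N (Nat.succ_pos n)
  have hMpos : 0 < M := Nat.div_pos (by omega) (by omega)
  have hMle : M * n + 1 ≤ N := by rw [mul_comm]; omega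
  have hMge : (N : ℝ) ≤ 2 * (n + 1) * M := by
    have : N ≤ 2 * (n * M + M) := by omega
    have h : (N : ℝ) ≤ 2 * (n * M + M) := by exact_mod_cast this
    linarith
  obtain ⟨e⟩ := exists_block_embedding A hMle
  have : Nonempty (Fin M) := ⟨⟨0, hMpos⟩⟩
  have : Nonempty (agents N) := ⟨e none⟩
  have hcmp := abs_canonicalMean_sub_integral_le (ν (a N)) hG hc (Real.exp_pos _) hν hq e e₀ (L N)
    hf ht htC
  have hbound := log_div_measureReal_sum_eq_le (ι := agents N) (ν (a N)) (T := T) (d := d)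
    (V := V + 1) (L := L N) hG hmono hc hθ ha1 hd hν h2
    (by
      simp only [div_pow, integral_div] at hV
      rwa [div_le_iff₀ (by positivity)] at hV)
    (by
      rw [integral_div] at hm
      rw [show ∫ k : ℕ, (k : ℝ) ∂(ν (a N)) - T * a N =
        ((∫ k : ℕ, (k : ℝ) ∂(ν (a N))) / a N - T) * a N by field_simp, abs_mul, abs_of_pos ha0]
      gcongr)
    (by
      rw [card_agents]
      rw [show (L N : ℝ) - (T + d) * (N * a N) = (L N / (N * a N) - (T + d)) * (N * a N) by
        field_simp, abs_mul, abs_of_pos (mul_pos hNR ha0)]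
      gcongr)
    (by rwa [card_agents]) (by rwa [card_agents])
  rw [card_agents] at hbound
  refine hcmp.trans (add_le_add_left ?_ _)
  rw [Fintype.card_fin]
  rw [div_le_iff₀ hNR] at hlog
  have hMR : (0 : ℝ) < M := by exact_mod_cast hMpos
  rw [div_le_div_iff₀ (by positivity) ht]
  have hdθ : 0 < d * θ := by positivity
  -- The 3 is 2 from tilting across the window plus 1 from `hlog`; then `N ≤ 2 * (n + 1) * M`.
  calc _ ≤ (3 * (d * θ) * N) * t := by gcongr; linarith
    _ ≤ (3 * (d * θ) * (2 * (n + 1) * M)) * t := by gcongr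
    _ = _ := by ring

end Asymptotic

/-! ### Regular variation and the grand canonical single-site law -/

/-- `G` is regularly varying of index `ρ` at scale `φ`, with a polynomial bound. -/
structure IsRegularlyVarying (G : ℕ → ℝ) (ρ : ℝ) (φ : ℝ → ℝ) : Prop where
  scale_pos : ∀ᶠ a in atTop, 0 < φ a
  tendsto : ∀ u : ℝ, 0 < u → Tendsto (fun a : ℝ => G ⌊u * a⌋₊ / φ a) atTop (𝓝 (u ^ ρ))
  bound : ∃ (C : ℝ) (p : ℕ), ∀ᶠ a in atTop, ∀ u : ℝ, 0 < u → G ⌊u * a⌋₊ ≤ C * (1 + u) ^ p * φ a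

/-- The unnormalized grand canonical density on the scale `a`. -/
noncomputable def gcDensity (G : ℕ → ℝ) (θ a u : ℝ) : ℝ :=
  G ⌊u * a⌋₊ * Real.exp (-(θ / a)) ^ ⌊u * a⌋₊

/-- The total mass of `gcDensity`. -/
noncomputable def gcNorm (G : ℕ → ℝ) (θ a : ℝ) : ℝ := ∫ u in Set.Ioi 0, gcDensity G θ a u

/-- The grand canonical single-site law, with mass proportional to `G k * exp (-θ k / a)`. -/
noncomputable def gcMeasure (G : ℕ → ℝ) (θ a : ℝ) : Measure ℕ :=
  ((volume.restrict (Set.Ioi 0)).withDensity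
    fun u => ((gcDensity G θ a u / gcNorm G θ a).toNNReal : ENNReal)).map fun u => ⌊u * a⌋₊

theorem measurable_natFloor_mul (a : ℝ) : Measurable fun u : ℝ => ⌊u * a⌋₊ :=
  Nat.measurable_floor.comp (measurable_mul_const a)

theorem measurable_gcDensity (G : ℕ → ℝ) (θ a : ℝ) : Measurable (gcDensity G θ a) := by
  have h2 : Measurable fun k : ℕ => G k * Real.exp (-(θ / a)) ^ k := measurable_of_countable _
  exact h2.comp (measurable_natFloor_mul a)

theorem gcDensity_nonneg {G : ℕ → ℝ} (hG : ∀ k, 0 < G k) (θ a u : ℝ) : 0 ≤ gcDensity G θ a u :=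
  mul_nonneg (hG _).le (pow_nonneg (Real.exp_pos _).le _)

theorem integral_gcMeasure {G : ℕ → ℝ} (hG : ∀ k, 0 < G k) (θ a : ℝ) (H : ℕ → ℝ) :
    ∫ k, H k ∂(gcMeasure G θ a) =
      (∫ u in Set.Ioi 0, H ⌊u * a⌋₊ * gcDensity G θ a u) / gcNorm G θ a := by
  have hnorm : 0 ≤ gcNorm G θ a := integral_nonneg fun u => gcDensity_nonneg hG θ a u
  rw [gcMeasure, integral_map
    (measurable_natFloor_mul a).aemeasurable
    (measurable_of_countable _).aestronglyMeasurable,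
    integral_withDensity_eq_integral_smul
      ((measurable_gcDensity G θ a).div_const _).real_toNNReal, ← integral_div]
  refine integral_congr_ae (ae_of_all _ fun u => ?_)
  simp only [NNReal.smul_def, smul_eq_mul]
  rw [Real.coe_toNNReal _ (div_nonneg (gcDensity_nonneg hG θ a u) hnorm)]
  ring

theorem integrable_gcMeasure {G : ℕ → ℝ} (hG : ∀ k, 0 < G k) (θ a : ℝ) {H : ℕ → ℝ}
    (hH : IntegrableOn (fun u => H ⌊u * a⌋₊ * gcDensity G θ a u) (Set.Ioi 0)) :
    Integrable H (gcMeasure G θ a) := by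
  have hnorm : 0 ≤ gcNorm G θ a := integral_nonneg fun u => gcDensity_nonneg hG θ a u
  rw [gcMeasure, integrable_map_measure (measurable_of_countable _).aestronglyMeasurable
    (measurable_natFloor_mul a).aemeasurable,
    integrable_withDensity_iff_integrable_smul
      ((measurable_gcDensity G θ a).div_const _).real_toNNReal]
  refine (hH.div_const (gcNorm G θ a)).congr (ae_of_all _ fun u => ?_)
  simp only [NNReal.smul_def, smul_eq_mul, Function.comp]
  rw [Real.coe_toNNReal _ (div_nonneg (gcDensity_nonneg hG θ a u) hnorm)]
  ring

/-- For `u > k / a` the density is at least `G k * exp (-θ u)`, because `G` is monotone and the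
floor rounds down. Integrating this tail bounds every point mass of `gcMeasure` by `θ / a`. -/
theorem mul_pow_le_mul_gcNorm {G : ℕ → ℝ} (hG : ∀ k, 0 < G k) (hmono : Monotone G) {θ a : ℝ}
    (hθ : 0 < θ) (ha : 0 < a) (hint : IntegrableOn (gcDensity G θ a) (Set.Ioi 0)) (k : ℕ) :
    G k * Real.exp (-(θ / a)) ^ k ≤ θ * gcNorm G θ a := by
  have hk : (0 : ℝ) ≤ k / a := by positivity
  have h1 : ∫ u in Set.Ioi (k / a), G k * Real.exp (-θ * u) ≤ gcNorm G θ a := by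
    refine le_trans ?_ (setIntegral_mono_set hint (ae_of_all _ fun u => gcDensity_nonneg hG θ a u)
      (Set.Ioi_subset_Ioi hk).eventuallyLE)
    refine setIntegral_mono_on ?_ (hint.mono_set (Set.Ioi_subset_Ioi hk)) measurableSet_Ioi ?_
    · exact (integrableOn_exp_mul_Ioi (by linarith) _).const_mul _
    · intro u hu
      have hu' : (k : ℝ) < u * a := by rwa [Set.mem_Ioi, div_lt_iff₀ ha] at hu
      have hfl : (⌊u * a⌋₊ : ℝ) ≤ u * a := Nat.floor_le (by linarith [Nat.cast_nonneg (α := ℝ) k])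
      refine mul_le_mul (hmono (Nat.le_floor hu'.le)) ?_ (Real.exp_pos _).le (hG _).le
      rw [← Real.exp_nat_mul]
      refine Real.exp_le_exp.2 ?_
      have : ⌊u * a⌋₊ * (θ / a) ≤ u * a * (θ / a) := by gcongr
      have h2 : u * a * (θ / a) = θ * u := by field_simp
      linarith
  rw [integral_const_mul, integral_exp_mul_Ioi (by linarith)] at h1
  have h2 : G k * Real.exp (-(θ / a)) ^ k = θ * (G k * (-Real.exp (-θ * (k / a)) / -θ)) := by
    rw [← Real.exp_nat_mul]
    have : (k : ℝ) * -(θ / a) = -θ * (k / a) := by ring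
    rw [this]
    field_simp
  rw [h2]
  gcongr

theorem gcNorm_pos {G : ℕ → ℝ} (hG : ∀ k, 0 < G k) (hmono : Monotone G) {θ a : ℝ}
    (hθ : 0 < θ) (ha : 0 < a) (hint : IntegrableOn (gcDensity G θ a) (Set.Ioi 0)) :
    0 < gcNorm G θ a := by
  have h := mul_pow_le_mul_gcNorm hG hmono hθ ha hint 0
  have h0 := hG 0
  rw [pow_zero, mul_one] at h
  exact pos_of_mul_pos_right (h0.trans_le h) hθ.le

theorem isProbabilityMeasure_gcMeasure {G : ℕ → ℝ} (hG : ∀ k, 0 < G k) {θ a : ℝ}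
    (hpos : 0 < gcNorm G θ a) (hint : IntegrableOn (gcDensity G θ a) (Set.Ioi 0)) :
    IsProbabilityMeasure (gcMeasure G θ a) := by
  refine ⟨?_⟩
  rw [gcMeasure, Measure.map_apply (measurable_natFloor_mul a)
    MeasurableSet.univ, Set.preimage_univ, withDensity_apply _ MeasurableSet.univ,
    Measure.restrict_univ]
  have := ofReal_integral_eq_lintegral_ofReal (hint.div_const (gcNorm G θ a))
    (ae_of_all _ fun u => div_nonneg (gcDensity_nonneg hG θ a u) hpos.le)
  rw [integral_div] at this
  change ∫⁻ u in Set.Ioi 0, ENNReal.ofReal (gcDensity G θ a u / gcNorm G θ a) = 1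
  rw [← this]
  change ENNReal.ofReal (gcNorm G θ a / gcNorm G θ a) = 1
  rw [div_self hpos.ne', ENNReal.ofReal_one]

theorem measureReal_gcMeasure_singleton {G : ℕ → ℝ} (hG : ∀ k, 0 < G k) {θ a : ℝ} (ha : 0 < a)
    (k : ℕ) : (gcMeasure G θ a).real {k} =
      (a * gcNorm G θ a)⁻¹ * G k * Real.exp (-(θ / a)) ^ k := by
  have h1 : (gcMeasure G θ a).real {k} =
      ∫ j, ({k} : Set ℕ).indicator (fun _ => (1 : ℝ)) j ∂(gcMeasure G θ a) := by
    rw [integral_indicator (measurableSet_singleton k)]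
    simp [Measure.real]
  have h2 : ∀ᵐ u : ℝ ∂(volume.restrict (Set.Ioi 0)),
      ({k} : Set ℕ).indicator (fun _ => (1 : ℝ)) ⌊u * a⌋₊ * gcDensity G θ a u =
      (Set.Ico ((k : ℝ) / a) ((k + 1) / a)).indicator
        (fun _ => G k * Real.exp (-(θ / a)) ^ k) u := by
    refine (ae_restrict_iff' measurableSet_Ioi).2 (ae_of_all _ fun u hu => ?_)
    have hu0 : 0 ≤ u * a := (mul_pos hu ha).le
    have hiff : ⌊u * a⌋₊ = k ↔ u ∈ Set.Ico ((k : ℝ) / a) ((k + 1) / a) := by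
      rw [Nat.floor_eq_iff hu0, Set.mem_Ico, div_le_iff₀ ha, lt_div_iff₀ ha]
    by_cases h : ⌊u * a⌋₊ = k
    · rw [Set.indicator_of_mem (hiff.1 h), Set.indicator_of_mem (by exact h), one_mul, gcDensity, h]
    · rw [Set.indicator_of_notMem (fun h' => h (hiff.2 h')), Set.indicator_of_notMem (by exact h),
        zero_mul]
  rw [h1, integral_gcMeasure hG, integral_congr_ae h2, integral_indicator measurableSet_Ico,
    Measure.restrict_restrict measurableSet_Ico, setIntegral_const]
  -- For `k = 0` the interval contains the endpoint 0, which `Set.Ioi 0` excludes; this is a null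
  -- set.
  have h3 : volume.real (Set.Ico ((k : ℝ) / a) ((k + 1) / a) ∩ Set.Ioi 0) = a⁻¹ := by
    have h4 : (Set.Ico ((k : ℝ) / a) ((k + 1) / a) ∩ Set.Ioi 0 : Set ℝ) =ᵐ[volume]
        Set.Ico ((k : ℝ) / a) ((k + 1) / a) := by
      have h5 : (Set.Ico ((k : ℝ) / a) ((k + 1) / a) ∩ Set.Ici 0 : Set ℝ) =
          Set.Ico ((k : ℝ) / a) ((k + 1) / a) :=
        Set.inter_eq_left.2 fun u hu => le_trans (by positivity) hu.1
      conv_rhs => rw [← h5]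
      exact (ae_eq_refl _).inter Ioi_ae_eq_Ici
    rw [measureReal_congr h4, Real.volume_real_Ico_of_le (by gcongr; linarith)]
    field_simp
    ring
  rw [h3, smul_eq_mul, mul_inv]
  ring

/-! ### Scaling limit of the single-site law -/

section Limit

variable {G : ℕ → ℝ} {ρ : ℝ} {φ : ℝ → ℝ}

theorem integrableOn_one_add_pow_mul_exp (p : ℕ) {θ : ℝ} (hθ : 0 < θ) :
    IntegrableOn (fun u : ℝ => (1 + u) ^ p * Real.exp (-(θ * u))) (Set.Ioi 0) := by
  refine integrable_of_isBigO_exp_neg (b := θ / 2) (by positivity) (by fun_prop) ?_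
  have h1 : (fun u : ℝ => (1 + u) ^ p) =O[atTop] fun u => Real.exp (θ / 2 * u) := by
    have h := (isLittleO_pow_exp_pos_mul_atTop p (b := θ / 2) (by positivity)).isBigO
    have h2 := h.comp_tendsto (tendsto_atTop_add_const_left atTop (1 : ℝ) tendsto_id)
    refine h2.trans ?_
    refine Asymptotics.IsBigO.of_bound (Real.exp (θ / 2)) (Eventually.of_forall fun u => ?_)
    simp only [Function.comp, id, Real.norm_eq_abs, Real.abs_exp]
    rw [← Real.exp_add]
    apply le_of_eq
    congr 1
    ring
  refine (h1.mul (Asymptotics.isBigO_refl _ _)).congr_right fun u => ?_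
  rw [← Real.exp_add]
  congr 1
  ring

/-- Supplies the dominating function. For `a ≥ 1`, flooring moves `u` down by at most 1 after
rescaling, whence the factor `exp θ`. -/
theorem IsRegularlyVarying.eventually_norm_le (hRV : IsRegularlyVarying G ρ φ)
    (hG : ∀ k, 0 < G k) {θ : ℝ} (hθ : 0 < θ) {h : ℝ → ℝ} {K : ℝ} {j : ℕ}
    (hK : ∀ u, 0 ≤ u → |h u| ≤ K * (1 + u) ^ j) :
    ∃ (B : ℝ) (p : ℕ), ∀ᶠ a in atTop, ∀ u : ℝ, 0 < u →
      ‖h (⌊u * a⌋₊ / a) * (gcDensity G θ a u / φ a)‖ ≤ B * ((1 + u) ^ p * Real.exp (-(θ * u))) := by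
  obtain ⟨C, p, hC⟩ := hRV.bound
  refine ⟨K * C * Real.exp θ, j + p, ?_⟩
  have hK0 : 0 ≤ K := by simpa using (abs_nonneg _).trans (hK 0 le_rfl)
  filter_upwards [hC, hRV.scale_pos, eventually_ge_atTop 1] with a hC hφ ha u hu
  have ha0 : 0 < a := by linarith
  have hua : 0 < u * a := mul_pos hu ha0
  have hfl : (⌊u * a⌋₊ : ℝ) / a ≤ u := by
    rw [div_le_iff₀ ha0]; exact Nat.floor_le hua.le
  have hfl2 : u - 1 ≤ (⌊u * a⌋₊ : ℝ) / a := by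
    rw [le_div_iff₀ ha0]
    have := Nat.lt_floor_add_one (u * a)
    nlinarith
  have h1 : |h (⌊u * a⌋₊ / a)| ≤ K * (1 + u) ^ j :=
    (hK _ (by positivity)).trans (by gcongr)
  have h2 : G ⌊u * a⌋₊ / φ a ≤ C * (1 + u) ^ p := by
    rw [div_le_iff₀ hφ]; exact hC u hu
  have h2' : 0 ≤ G ⌊u * a⌋₊ / φ a := div_nonneg (hG _).le hφ.le
  have h3 : Real.exp (-(θ / a)) ^ ⌊u * a⌋₊ ≤ Real.exp θ * Real.exp (-(θ * u)) := by
    rw [← Real.exp_nat_mul, ← Real.exp_add]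
    refine Real.exp_le_exp.2 ?_
    have : θ * (u - 1) ≤ θ * ((⌊u * a⌋₊ : ℝ) / a) := by gcongr
    have h4 : (⌊u * a⌋₊ : ℝ) * -(θ / a) = -(θ * ((⌊u * a⌋₊ : ℝ) / a)) := by ring
    linarith
  have h5 : gcDensity G θ a u / φ a = G ⌊u * a⌋₊ / φ a * Real.exp (-(θ / a)) ^ ⌊u * a⌋₊ := by
    rw [gcDensity]; ring
  rw [Real.norm_eq_abs, abs_mul, h5, abs_of_nonneg (a := G ⌊u * a⌋₊ / φ a * _) (by positivity)]
  calc _ ≤ K * (1 + u) ^ j * (C * (1 + u) ^ p * (Real.exp θ * Real.exp (-(θ * u)))) := by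
        gcongr
        exact h2'.trans h2
    _ = _ := by rw [pow_add]; ring

theorem aestronglyMeasurable_scaled_mul_gcDensity (G : ℕ → ℝ) (h : ℝ → ℝ) (θ a b : ℝ)
    (μ : Measure ℝ) :
    AEStronglyMeasurable (fun u => h (⌊u * a⌋₊ / a) * (gcDensity G θ a u / b)) μ := by
  have h2 : Measurable fun k : ℕ => h (k / a) := measurable_of_countable _
  exact ((h2.comp (measurable_natFloor_mul a)).mul ((measurable_gcDensity G θ a).div_const b)).aestronglyMeasurable

theorem IsRegularlyVarying.eventually_integrableOn (hRV : IsRegularlyVarying G ρ φ)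
    (hG : ∀ k, 0 < G k) {θ : ℝ} (hθ : 0 < θ) {h : ℝ → ℝ} {K : ℝ} {j : ℕ}
    (hK : ∀ u, 0 ≤ u → |h u| ≤ K * (1 + u) ^ j) :
    ∀ᶠ a in atTop,
      IntegrableOn (fun u => h (⌊u * a⌋₊ / a) * gcDensity G θ a u) (Set.Ioi 0) := by
  obtain ⟨B, p, hB⟩ := hRV.eventually_norm_le hG hθ hK
  filter_upwards [hB, hRV.scale_pos] with a hB hφ
  have : IntegrableOn (fun u => h (⌊u * a⌋₊ / a) * (gcDensity G θ a u / φ a)) (Set.Ioi 0) :=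
    ((integrableOn_one_add_pow_mul_exp p hθ).const_mul B).mono'
      (aestronglyMeasurable_scaled_mul_gcDensity G h θ a (φ a) _)
      ((ae_restrict_iff' measurableSet_Ioi).2 (ae_of_all _ hB))
  refine (this.mul_const (φ a)).congr (ae_of_all _ fun u => ?_)
  field_simp

theorem IsRegularlyVarying.tendsto_integral (hRV : IsRegularlyVarying G ρ φ)
    (hG : ∀ k, 0 < G k) {θ : ℝ} (hθ : 0 < θ) {h : ℝ → ℝ} (hh : Continuous h) {K : ℝ} {j : ℕ}
    (hK : ∀ u, 0 ≤ u → |h u| ≤ K * (1 + u) ^ j) :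
    Tendsto (fun a => ∫ u in Set.Ioi 0, h (⌊u * a⌋₊ / a) * (gcDensity G θ a u / φ a)) atTop
      (𝓝 (∫ u in Set.Ioi 0, h u * (u ^ ρ * Real.exp (-(θ * u))))) := by
  obtain ⟨B, p, hB⟩ := hRV.eventually_norm_le hG hθ hK
  refine tendsto_integral_filter_of_dominated_convergence
    (fun u => B * ((1 + u) ^ p * Real.exp (-(θ * u))))
    (Eventually.of_forall fun a => aestronglyMeasurable_scaled_mul_gcDensity G h θ a (φ a) _)
    ?_ ((integrableOn_one_add_pow_mul_exp p hθ).const_mul B) ?_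
  · filter_upwards [hB] with a hB
    exact (ae_restrict_iff' measurableSet_Ioi).2 (ae_of_all _ hB)
  · refine (ae_restrict_iff' measurableSet_Ioi).2 (ae_of_all _ fun u hu => ?_)
    have hfl : Tendsto (fun a : ℝ => (⌊u * a⌋₊ : ℝ) / a) atTop (𝓝 u) :=
      tendsto_nat_floor_mul_div_atTop (le_of_lt hu)
    have hexp : Tendsto (fun a : ℝ => Real.exp (-(θ / a)) ^ ⌊u * a⌋₊) atTop
        (𝓝 (Real.exp (-(θ * u)))) := by
      have : Tendsto (fun a : ℝ => Real.exp (-(θ * ((⌊u * a⌋₊ : ℝ) / a)))) atTop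
          (𝓝 (Real.exp (-(θ * u)))) :=
        (Real.continuous_exp.tendsto _).comp ((hfl.const_mul θ).neg)
      refine this.congr fun a => ?_
      rw [← Real.exp_nat_mul]
      congr 1
      ring
    refine ((hh.tendsto u).comp hfl).mul (((hRV.tendsto u hu).mul hexp).congr fun a => ?_)
    rw [gcDensity]
    ring

theorem integral_rpow_mul_exp (hρ : 0 ≤ ρ) {θ : ℝ} (hθ : 0 < θ) :
    ∫ u in Set.Ioi 0, u ^ ρ * Real.exp (-(θ * u)) = (1 / θ) ^ (ρ + 1) * Real.Gamma (ρ + 1) := by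
  have := Real.integral_rpow_mul_exp_neg_mul_Ioi (a := ρ + 1) (by linarith) hθ
  simpa using this

/-- Writes Gamma expectations as ratios of unnormalized integrals, the form in which `gcMeasure`
expectations converge. -/
theorem integral_gammaMeasure (hρ : 0 ≤ ρ) {θ : ℝ} (hθ : 0 < θ) (h : ℝ → ℝ) :
    ∫ u, h u ∂(gammaMeasure (ρ + 1) θ) =
      (∫ u in Set.Ioi 0, h u * (u ^ ρ * Real.exp (-(θ * u)))) /
        ∫ u in Set.Ioi 0, u ^ ρ * Real.exp (-(θ * u)) := by
  have hΓ : 0 < Real.Gamma (ρ + 1) := Real.Gamma_pos_of_pos (by linarith)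
  have h1 : gammaMeasure (ρ + 1) θ =
      volume.withDensity fun u => ((gammaPDFReal (ρ + 1) θ u).toNNReal : ENNReal) := rfl
  rw [h1, integral_withDensity_eq_integral_smul (measurable_gammaPDFReal _ _).real_toNNReal,
    integral_rpow_mul_exp hρ hθ, ← integral_div, ← integral_indicator measurableSet_Ioi]
  refine integral_congr_ae ?_
  filter_upwards [compl_mem_ae_iff.2 (Real.volume_singleton (a := 0))] with u hu
  rw [NNReal.smul_def, Real.coe_toNNReal _ (gammaPDFReal_nonneg (by linarith) hθ u), smul_eq_mul,
    gammaPDFReal]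
  rcases lt_or_gt_of_ne (show u ≠ 0 from hu) with hu | hu
  · rw [if_neg (not_le.2 hu), Set.indicator_of_notMem (by simpa using hu.le), zero_mul]
  · rw [if_pos hu.le, Set.indicator_of_mem (by exact hu), Real.div_rpow zero_le_one hθ.le,
      Real.one_rpow, add_sub_cancel_right]
    have := Real.rpow_pos_of_pos hθ (ρ + 1)
    field_simp

/-- The rescaled grand canonical laws converge to a Gamma law, along test functions of polynomial
growth. -/
theorem IsRegularlyVarying.tendsto_integral_gcMeasure (hRV : IsRegularlyVarying G ρ φ)
    (hρ : 0 ≤ ρ) (hG : ∀ k, 0 < G k) {θ : ℝ} (hθ : 0 < θ) {h : ℝ → ℝ} (hh : Continuous h)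
    {K : ℝ} {j : ℕ} (hK : ∀ u, 0 ≤ u → |h u| ≤ K * (1 + u) ^ j) :
    Tendsto (fun a => ∫ k : ℕ, h (k / a) ∂(gcMeasure G θ a)) atTop
      (𝓝 (∫ u, h u ∂(gammaMeasure (ρ + 1) θ))) := by
  rw [integral_gammaMeasure hρ hθ]
  have h1 := hRV.tendsto_integral hG hθ hh hK
  have h2 := hRV.tendsto_integral hG hθ (h := fun _ => 1) continuous_const (K := 1) (j := 0)
    (by simp)
  simp only [one_mul] at h2
  have hpos : 0 < ∫ u in Set.Ioi 0, u ^ ρ * Real.exp (-(θ * u)) := by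
    rw [integral_rpow_mul_exp hρ hθ]
    have := Real.Gamma_pos_of_pos (show 0 < ρ + 1 by linarith)
    positivity
  refine (h1.div h2 hpos.ne').congr' ?_
  filter_upwards [hRV.scale_pos] with a hφ
  simp only [Pi.div_apply]
  rw [integral_gcMeasure hG, gcNorm, integral_div]
  simp only [← mul_div_assoc]
  rw [integral_div, div_div_div_cancel_right₀ hφ.ne']

theorem integral_id_gammaMeasure (hρ : 0 ≤ ρ) {θ : ℝ} (hθ : 0 < θ) :
    ∫ u, u ∂(gammaMeasure (ρ + 1) θ) = (ρ + 1) / θ := by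
  rw [integral_gammaMeasure hρ hθ fun u => u]
  have h1 : ∫ u in Set.Ioi 0, u * (u ^ ρ * Real.exp (-(θ * u))) =
      ∫ u in Set.Ioi 0, u ^ (ρ + 1) * Real.exp (-(θ * u)) := by
    refine setIntegral_congr_fun measurableSet_Ioi fun u hu => ?_
    rw [Real.rpow_add_one (ne_of_gt hu)]
    ring
  rw [h1, integral_rpow_mul_exp hρ hθ, integral_rpow_mul_exp (by linarith) hθ,
    Real.Gamma_add_one (show ρ + 1 ≠ 0 by linarith),
    Real.rpow_add_one (show (1 / θ) ≠ 0 by positivity)]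
  have := Real.Gamma_pos_of_pos (show 0 < ρ + 1 by linarith)
  have := Real.rpow_pos_of_pos (show 0 < 1 / θ by positivity) (ρ + 1)
  field_simp

end Limit

/-! ### Regular variation of the partial sums -/

section Weights

theorem cumWeight_mono {g : ℕ → ℝ} (hg : ∀ k, 0 ≤ g k) : Monotone (cumWeight g) := fun k l h =>
  Finset.sum_le_sum_of_subset_of_nonneg (Finset.range_mono (by omega)) fun i _ _ => hg i

theorem cumWeight_pos {g : ℕ → ℝ} (hg : ∀ k, 0 ≤ g k) (hg0 : 0 < g 0) (k : ℕ) :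
    0 < cumWeight g k := by
  refine lt_of_lt_of_le ?_ (cumWeight_mono hg (Nat.zero_le k))
  simpa [cumWeight] using hg0

/-- If `g / δ → c` where `δ ≥ 0` are the increments of a function `s` tending to infinity, then
the partial sums satisfy `G / s → c`. -/
theorem tendsto_cumWeight_div {g s : ℕ → ℝ} {c : ℝ} (hs : StrictMono s)
    (hs' : Tendsto s atTop atTop)
    (h : Tendsto (fun k => g k / (s (k + 1) - s k)) atTop (𝓝 c)) :
    Tendsto (fun k => cumWeight g k / s (k + 1)) atTop (𝓝 c) := by
  set δ : ℕ → ℝ := fun k => s (k + 1) - s k with hδ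
  have hδpos : ∀ k, 0 < δ k := fun k => sub_pos.2 (hs (Nat.lt_succ_self k))
  have hsumδ : ∀ n, ∑ i ∈ Finset.range n, δ i = s n - s 0 := fun n => Finset.sum_range_sub s n
  have hlittle : (fun k => g k - c * δ k) =o[atTop] δ := by
    rw [Asymptotics.isLittleO_iff_tendsto fun k hk => absurd hk (hδpos k).ne']
    have := h.sub_const c
    rw [sub_self] at this
    refine this.congr fun k => ?_
    have := (hδpos k).ne'
    change g k / δ k - c = (g k - c * δ k) / δ k
    field_simp
  have htop : Tendsto (fun n => ∑ i ∈ Finset.range n, δ i) atTop atTop := by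
    simp only [hsumδ]
    exact tendsto_atTop_add_const_right _ (-s 0) hs'
  have h1 := (hlittle.sum_range (fun k => (hδpos k).le) htop).tendsto_div_nhds_zero
  have h2 : Tendsto (fun n => (s n - s 0) / s n) atTop (𝓝 1) := by
    have : Tendsto (fun n => 1 - s 0 / s n) atTop (𝓝 (1 - 0)) :=
      tendsto_const_nhds.sub (hs'.const_div_atTop _)
    rw [sub_zero] at this
    refine this.congr' ?_
    filter_upwards [hs'.eventually_gt_atTop 0] with n hn
    field_simp
  have h3 : Tendsto (fun n => (∑ i ∈ Finset.range n, g i) / s n) atTop (𝓝 c) := by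
    have := (h1.add_const c).mul h2
    rw [zero_add, mul_one] at this
    refine this.congr' ?_
    filter_upwards [hs'.eventually_gt_atTop 0, htop.eventually_gt_atTop 0] with n hn hn'
    simp only [Finset.sum_sub_distrib, ← Finset.mul_sum]
    rw [hsumδ] at hn' ⊢
    field_simp
    ring
  -- The shift by one matches `cumWeight g k`, which sums over `range (k + 1)`.
  exact h3.comp (tendsto_add_atTop_nat 1)

theorem tendsto_slope_mul {F : ℝ → ℝ} {F' : ℝ} (hF : HasDerivAt F F' 1) :
    Tendsto (fun k : ℕ => (k : ℝ) * (F (1 + 1 / k) - F 1)) atTop (𝓝 F') := by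
  have h0 : Tendsto (fun k : ℕ => 1 / (k : ℝ)) atTop (𝓝[≠] 0) := by
    refine tendsto_nhdsWithin_iff.2 ⟨tendsto_one_div_atTop_nhds_zero_nat, ?_⟩
    filter_upwards [eventually_gt_atTop 0] with k hk
    have : (k : ℝ) ≠ 0 := by positivity
    simpa using this
  refine ((hasDerivAt_iff_tendsto_slope_zero.1 hF).comp h0).congr fun k => ?_
  simp

/-- Identifies `k ^ α` with the increments of `k ^ (α + 1) / (α + 1)`, so that
`tendsto_cumWeight_div` applies; the logarithm plays this role at `α = -1`. -/
theorem tendsto_rpow_increment {β : ℝ} (hβ : 0 < β) :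
    Tendsto (fun k : ℕ => (((k + 1 : ℕ) : ℝ) ^ β / β - (k : ℝ) ^ β / β) / (k : ℝ) ^ (β - 1)) atTop
      (𝓝 1) := by
  have h1 : HasDerivAt (fun x : ℝ => x ^ β / β) 1 1 := by
    have := (Real.hasDerivAt_rpow_const (x := 1) (p := β) (Or.inl one_ne_zero)).div_const β
    rwa [Real.one_rpow, mul_one, div_self hβ.ne'] at this
  refine (tendsto_slope_mul h1).congr' ?_
  filter_upwards [eventually_gt_atTop 0] with k hk
  have hk' : (0 : ℝ) < k := by exact_mod_cast hk
  have h2 : ((k + 1 : ℕ) : ℝ) = k * (1 + 1 / k) := by push_cast; field_simp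
  rw [h2, Real.mul_rpow hk'.le (by positivity), Real.rpow_sub_one hk'.ne', Real.one_rpow]
  have := Real.rpow_pos_of_pos hk' β
  field_simp

theorem tendsto_log_increment :
    Tendsto (fun k : ℕ => (Real.log ((k + 1 : ℕ) + 1) - Real.log (k + 1)) / (k : ℝ) ^ (-1 : ℝ)) atTop
      (𝓝 1) := by
  have h1 : HasDerivAt Real.log 1 1 := by
    simpa using Real.hasDerivAt_log one_ne_zero
  -- The comparison function is `log (k + 1)`, so the increment is naturally of size `1 / (k + 1)`;
  -- `h3` converts this to `1 / k`.
  have h2 := (tendsto_slope_mul h1).comp (tendsto_add_atTop_nat 1)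
  have h3 : Tendsto (fun k : ℕ => (k : ℝ) / ((k + 1 : ℕ) : ℝ)) atTop (𝓝 1) := by
    simpa using tendsto_natCast_div_add_atTop (1 : ℝ)
  have h4 := h2.mul h3
  rw [mul_one] at h4
  refine h4.congr' ?_
  filter_upwards [eventually_gt_atTop 0] with k hk
  have hk' : (0 : ℝ) < k := by exact_mod_cast hk
  have h5 : ((k + 1 : ℕ) : ℝ) + 1 = (k + 1) * (1 + 1 / ((k + 1 : ℕ) : ℝ)) := by
    push_cast; field_simp
  rw [h5, Real.log_mul (by positivity) (by positivity), Real.rpow_neg_one]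
  simp only [Function.comp, Real.log_one, sub_zero]
  push_cast
  field_simp
  ring

theorem exists_bound_of_tendsto_div {G s : ℕ → ℝ} {c : ℝ} (hs : ∀ k, 0 < s k)
    (h : Tendsto (fun k => G k / s k) atTop (𝓝 c)) : ∃ B, 0 < B ∧ ∀ k, G k ≤ B * s k := by
  obtain ⟨B, hB⟩ := h.bddAbove_range
  refine ⟨max B 1, by positivity, fun k => ?_⟩
  have := hB ⟨k, rfl⟩
  rw [← div_le_iff₀ (hs k)]
  exact this.trans (le_max_left _ _)

theorem isRegularlyVarying_of_rpow {G : ℕ → ℝ} {ρ c : ℝ} (hρ : 0 ≤ ρ) (hc : 0 < c)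
    (h : Tendsto (fun k : ℕ => G k / ((k : ℝ) + 1) ^ ρ) atTop (𝓝 c)) :
    IsRegularlyVarying G ρ fun a => c * a ^ ρ where
  scale_pos := by
    filter_upwards [eventually_gt_atTop 0] with a ha
    positivity
  tendsto u hu := by
    have hfl : Tendsto (fun a : ℝ => (⌊u * a⌋₊ : ℝ) / a) atTop (𝓝 u) :=
      tendsto_nat_floor_mul_div_atTop hu.le
    have hN : Tendsto (fun a : ℝ => ⌊u * a⌋₊) atTop atTop :=
      tendsto_nat_floor_atTop.comp (tendsto_id.const_mul_atTop hu)
    have h1 : Tendsto (fun a : ℝ => ((⌊u * a⌋₊ : ℝ) / a + 1 / a) ^ ρ) atTop (𝓝 ((u + 0) ^ ρ)) :=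
      (hfl.add (tendsto_const_nhds.div_atTop tendsto_id)).rpow_const (Or.inr hρ)
    have h2 := ((h.comp hN).mul h1).div_const c
    rw [add_zero, mul_div_cancel_left₀ _ hc.ne'] at h2
    refine h2.congr' ?_
    filter_upwards [eventually_gt_atTop 0] with a ha
    simp only [Function.comp]
    rw [← add_div, Real.div_rpow (by positivity) ha.le]
    have : (0 : ℝ) < ((⌊u * a⌋₊ : ℝ) + 1) ^ ρ := by positivity
    have := Real.rpow_pos_of_pos ha ρ
    field_simp
  bound := by
    obtain ⟨B, hB, hB'⟩ := exists_bound_of_tendsto_div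
      (fun k => Real.rpow_pos_of_pos (by positivity) ρ) h
    refine ⟨B / c, ⌈ρ⌉₊, ?_⟩
    filter_upwards [eventually_ge_atTop 1] with a ha u hu
    have ha0 : 0 < a := by linarith
    have hfl : (⌊u * a⌋₊ : ℝ) ≤ u * a := Nat.floor_le (mul_pos hu ha0).le
    calc G ⌊u * a⌋₊ ≤ B * ((⌊u * a⌋₊ : ℝ) + 1) ^ ρ := hB' _
      _ ≤ B * ((1 + u) * a) ^ ρ := by
        gcongr
        linarith
      _ = B * ((1 + u) ^ ρ * a ^ ρ) := by rw [Real.mul_rpow (by positivity) ha0.le]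
      _ ≤ B * ((1 + u) ^ ⌈ρ⌉₊ * a ^ ρ) := by
        gcongr
        rw [← Real.rpow_natCast]
        exact Real.rpow_le_rpow_of_exponent_le (by linarith) (Nat.le_ceil ρ)
      _ = _ := by field_simp

/-- The logarithm is slowly varying, so the index is 0. The shift by 2 keeps the comparison function
positive at every `k`. -/
theorem isRegularlyVarying_of_log {G : ℕ → ℝ} {c : ℝ} (hc : 0 < c)
    (h : Tendsto (fun k : ℕ => G k / Real.log ((k : ℝ) + 2)) atTop (𝓝 c)) :
    IsRegularlyVarying G 0 fun a => c * Real.log a where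
  scale_pos := by
    filter_upwards [eventually_gt_atTop 1] with a ha
    exact mul_pos hc (Real.log_pos ha)
  tendsto u hu := by
    have hfl : Tendsto (fun a : ℝ => (⌊u * a⌋₊ : ℝ) / a) atTop (𝓝 u) :=
      tendsto_nat_floor_mul_div_atTop hu.le
    have hN : Tendsto (fun a : ℝ => ⌊u * a⌋₊) atTop atTop :=
      tendsto_nat_floor_atTop.comp (tendsto_id.const_mul_atTop hu)
    have h1 : Tendsto (fun a : ℝ => Real.log ((⌊u * a⌋₊ : ℝ) / a + 2 / a)) atTop
        (𝓝 (Real.log (u + 0))) :=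
      (hfl.add (tendsto_const_nhds.div_atTop tendsto_id)).log (by simpa using hu.ne')
    -- `log (⌊u * a⌋ + 2) / log a` equals `1 + log ((⌊u * a⌋ + 2) / a) / log a`, and the last
    -- numerator stays bounded.
    have h2 := (h1.div_atTop Real.tendsto_log_atTop).add_const 1
    have h3 := ((h.comp hN).mul h2).div_const c
    rw [zero_add, mul_one, div_self hc.ne'] at h3
    rw [Real.rpow_zero]
    refine h3.congr' ?_
    filter_upwards [eventually_gt_atTop 1] with a ha
    simp only [Function.comp]
    have ha0 : 0 < a := by linarith
    rw [← add_div, Real.log_div (by positivity) ha0.ne']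
    have : 0 < Real.log a := Real.log_pos ha
    have : 0 < Real.log ((⌊u * a⌋₊ : ℝ) + 2) := Real.log_pos (by
      have : (0 : ℝ) ≤ ⌊u * a⌋₊ := by positivity
      linarith)
    field_simp
    ring
  bound := by
    obtain ⟨B, hB, hB'⟩ := exists_bound_of_tendsto_div (fun k => Real.log_pos (by
      have : (0 : ℝ) ≤ k := by positivity
      linarith)) h
    refine ⟨3 * B / c, 1, ?_⟩
    filter_upwards [eventually_ge_atTop (Real.exp 1)] with a ha u hu
    have ha2 : 2 ≤ a := by linarith [Real.add_one_le_exp (1 : ℝ)]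
    have ha0 : 0 < a := by linarith
    have hlog : 1 ≤ Real.log a := by
      rw [Real.le_log_iff_exp_le ha0]
      exact ha
    have hfl : (⌊u * a⌋₊ : ℝ) ≤ u * a := Nat.floor_le (mul_pos hu ha0).le
    have h1 : Real.log ((⌊u * a⌋₊ : ℝ) + 2) ≤ Real.log (1 + u) + Real.log a := by
      rw [← Real.log_mul (by positivity) ha0.ne']
      refine Real.log_le_log (by positivity) ?_
      linarith
    have h2 : Real.log (1 + u) ≤ u := by
      have := Real.log_le_sub_one_of_pos (show 0 < 1 + u by linarith)
      linarith
    calc G ⌊u * a⌋₊ ≤ B * Real.log ((⌊u * a⌋₊ : ℝ) + 2) := hB' _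
      _ ≤ B * (3 * (1 + u) * Real.log a) := by
        gcongr
        nlinarith
      _ = _ := by field_simp

theorem exists_isRegularlyVarying_of_summable {g : ℕ → ℝ} (hg : ∀ k, 0 ≤ g k) (hg0 : 0 < g 0)
    (hs : Summable g) : ∃ φ, IsRegularlyVarying (cumWeight g) 0 φ := by
  refine ⟨_, isRegularlyVarying_of_rpow (c := ∑' k, g k) le_rfl (hs.tsum_pos hg 0 hg0) ?_⟩
  simpa [cumWeight, Function.comp_def] using (hs.hasSum.tendsto_sum_nat).comp (tendsto_add_atTop_nat 1)

theorem exists_isRegularlyVarying_of_neg_one_lt {g : ℕ → ℝ} {α c : ℝ} (hα : -1 < α)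
    (hc : 0 < c) (h : Tendsto (fun k : ℕ => g k / (k : ℝ) ^ α) atTop (𝓝 c)) :
    ∃ φ, IsRegularlyVarying (cumWeight g) (α + 1) φ := by
  have hα' : 0 < α + 1 := by linarith
  have h1 := tendsto_rpow_increment hα'
  rw [add_sub_cancel_right] at h1
  have hlim : Tendsto (fun k => cumWeight g k / (((k + 1 : ℕ) : ℝ) ^ (α + 1) / (α + 1))) atTop
      (𝓝 c) := by
    refine tendsto_cumWeight_div (s := fun k : ℕ => (k : ℝ) ^ (α + 1) / (α + 1)) ?_ ?_ ?_
    · intro k l hkl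
      have : (k : ℝ) < l := by exact_mod_cast hkl
      beta_reduce
      gcongr
    · exact ((tendsto_rpow_atTop hα').comp tendsto_natCast_atTop_atTop).atTop_div_const hα'
    · have h2 := h.div h1 one_ne_zero
      rw [div_one] at h2
      refine h2.congr' ?_
      filter_upwards [eventually_gt_atTop 0] with k hk
      have := Real.rpow_pos_of_pos (show (0 : ℝ) < k by exact_mod_cast hk) α
      simp only [Pi.div_apply]
      rw [div_div_div_cancel_right₀ this.ne']
  refine ⟨_, isRegularlyVarying_of_rpow (c := c / (α + 1)) hα'.le (by positivity) ?_⟩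
  refine (hlim.div_const (α + 1)).congr fun k => ?_
  push_cast
  have : (0 : ℝ) < ((k : ℝ) + 1) ^ (α + 1) := by positivity
  field_simp

theorem exists_isRegularlyVarying_of_eq_neg_one {g : ℕ → ℝ} {c : ℝ}
    (hc : 0 < c) (h : Tendsto (fun k : ℕ => g k / (k : ℝ) ^ (-1 : ℝ)) atTop (𝓝 c)) :
    ∃ φ, IsRegularlyVarying (cumWeight g) 0 φ := by
  refine ⟨_, isRegularlyVarying_of_log (c := c) hc ?_⟩
  have hlim : Tendsto (fun k => cumWeight g k / Real.log (((k + 1 : ℕ) : ℝ) + 1)) atTop (𝓝 c) := by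
    refine tendsto_cumWeight_div (s := fun k : ℕ => Real.log (k + 1)) ?_ ?_ ?_
    · intro k l hkl
      have : (k : ℝ) < l := by exact_mod_cast hkl
      exact Real.log_lt_log (by positivity) (by linarith)
    · exact Real.tendsto_log_atTop.comp
        (tendsto_atTop_add_const_right _ _ tendsto_natCast_atTop_atTop)
    · have h2 := h.div tendsto_log_increment one_ne_zero
      rw [div_one] at h2
      refine h2.congr' ?_
      filter_upwards [eventually_gt_atTop 0] with k hk
      have := Real.rpow_pos_of_pos (show (0 : ℝ) < k by exact_mod_cast hk) (-1)
      simp only [Pi.div_apply]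
      rw [div_div_div_cancel_right₀ this.ne']
  refine hlim.congr fun k => ?_
  congr 2
  push_cast
  ring

theorem summable_of_tendsto_div_rpow {g : ℕ → ℝ} {α c : ℝ} (hα : α < -1)
    (h : Tendsto (fun k : ℕ => g k / (k : ℝ) ^ α) atTop (𝓝 c)) : Summable g := by
  refine summable_of_isBigO_nat (Real.summable_nat_rpow.2 hα) ?_
  refine Asymptotics.isBigO_of_div_tendsto_nhds ?_ c h
  filter_upwards [eventually_gt_atTop 0] with k hk h0
  exact absurd h0 (Real.rpow_pos_of_pos (show (0 : ℝ) < k by exact_mod_cast hk) α).ne'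

end Weights

/-! ### Passing to the limit -/

section Main

open scoped BoundedContinuousFunction

theorem tendsto_integral_pi_of_forall_tendsto {β A : Type*} [Fintype A] {l : Filter β}
    {μs : β → Measure ℝ} {μ : Measure ℝ} [IsProbabilityMeasure μ]
    (hp : ∀ᶠ b in l, IsProbabilityMeasure (μs b))
    (h : ∀ f : ℝ →ᵇ ℝ, Tendsto (fun b => ∫ x, f x ∂(μs b)) l (𝓝 (∫ x, f x ∂μ)))
    (f : (A → ℝ) →ᵇ ℝ) :
    Tendsto (fun b => ∫ x, f x ∂(Measure.pi fun _ : A => μs b)) l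
      (𝓝 (∫ x, f x ∂(Measure.pi fun _ : A => μ))) := by
  classical
  let P : ProbabilityMeasure ℝ := ⟨μ, inferInstance⟩
  -- The default value is the limit itself; it is eventually not used.
  let Q : β → ProbabilityMeasure ℝ := fun b =>
    if hb : IsProbabilityMeasure (μs b) then ⟨μs b, hb⟩ else P
  have hQ : ∀ᶠ b in l, (Q b : Measure ℝ) = μs b := by
    filter_upwards [hp] with b hb
    simp [Q, hb]
  have hlim : Tendsto Q l (𝓝 P) := by
    rw [ProbabilityMeasure.tendsto_iff_forall_integral_tendsto]
    intro f
    refine (h f).congr' ?_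
    filter_upwards [hQ] with b hb
    rw [hb]
  have hpi : Tendsto (fun b => ProbabilityMeasure.pi fun _ : A => Q b) l
      (𝓝 (ProbabilityMeasure.pi fun _ : A => P)) :=
    (ProbabilityMeasure.continuous_pi.tendsto _).comp (tendsto_pi_nhds.2 fun _ => hlim)
  rw [ProbabilityMeasure.tendsto_iff_forall_integral_tendsto] at hpi
  refine (hpi f).congr' ?_
  filter_upwards [hQ] with b hb
  simp [ProbabilityMeasure.toMeasure_pi, hb]

/-- Continuity in the rate removes the bias introduced by tuning the mean to `T₀ < T`. -/
theorem tendsto_integral_gammaMeasure {ρ θ : ℝ} (hρ : 0 ≤ ρ) (hθ : 0 < θ) (f : ℝ →ᵇ ℝ) :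
    Tendsto (fun θ' => ∫ u, f u ∂(gammaMeasure (ρ + 1) θ')) (𝓝 θ)
      (𝓝 (∫ u, f u ∂(gammaMeasure (ρ + 1) θ))) := by
  have hkey : ∀ h : ℝ →ᵇ ℝ, Tendsto
      (fun θ' => ∫ u in Set.Ioi 0, h u * (u ^ ρ * Real.exp (-(θ' * u)))) (𝓝 θ)
      (𝓝 (∫ u in Set.Ioi 0, h u * (u ^ ρ * Real.exp (-(θ * u))))) := by
    intro h
    refine tendsto_integral_filter_of_dominated_convergence
      (fun u => ‖h‖ * ((1 + u) ^ ⌈ρ⌉₊ * Real.exp (-(θ / 2 * u)))) ?_ ?_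
      ((integrableOn_one_add_pow_mul_exp _ (by positivity)).const_mul _) ?_
    · exact Eventually.of_forall fun θ' => by
        have : Continuous fun u : ℝ => u ^ ρ := Real.continuous_rpow_const hρ
        exact (h.continuous.mul (this.mul (by fun_prop))).aestronglyMeasurable
    · filter_upwards [eventually_ge_nhds (show θ / 2 < θ by linarith)] with θ' hθ'
      refine (ae_restrict_iff' measurableSet_Ioi).2 (ae_of_all _ fun u hu => ?_)
      have hu : 0 < u := hu
      have h1 : u ^ ρ ≤ (1 + u) ^ ⌈ρ⌉₊ := by
        rw [← Real.rpow_natCast]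
        exact (Real.rpow_le_rpow hu.le (by linarith) hρ).trans
          (Real.rpow_le_rpow_of_exponent_le (by linarith) (Nat.le_ceil ρ))
      have h2 := Real.rpow_pos_of_pos hu ρ
      rw [norm_mul, Real.norm_of_nonneg (r := u ^ ρ * _) (by positivity)]
      gcongr
      exact h.norm_coe_le_norm u
    · refine ae_of_all _ fun u => ?_
      have : Continuous fun θ' : ℝ => h u * (u ^ ρ * Real.exp (-(θ' * u))) := by fun_prop
      exact this.tendsto θ
  have h1 := hkey (BoundedContinuousFunction.const ℝ 1)
  simp only [BoundedContinuousFunction.const_apply, one_mul] at h1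
  have hpos : 0 < ∫ u in Set.Ioi 0, u ^ ρ * Real.exp (-(θ * u)) := by
    rw [integral_rpow_mul_exp hρ hθ]
    have := Real.Gamma_pos_of_pos (show 0 < ρ + 1 by linarith)
    positivity
  rw [integral_gammaMeasure hρ hθ]
  refine ((hkey f).div h1 hpos.ne').congr' ?_
  filter_upwards [eventually_gt_nhds hθ] with θ' hθ'
  rw [integral_gammaMeasure hρ hθ']
  rfl

theorem scaledField_eq {N : ℕ} {b : ℝ} {A : Finset ℕ} (e₀ : A ↪ agents N)
    (he : ∀ x, (e₀ x : ℕ) = x) (η : agents N → ℕ) :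
    scaledField N b A η = fun x => ((η ∘ e₀) x : ℝ) / b := by
  funext x
  have hx : (x : ℕ) ∈ agents N := he x ▸ (e₀ x).2
  have : (⟨x, hx⟩ : agents N) = e₀ x := Subtype.ext (he x).symm
  simp [scaledField, hx, this]

theorem exists_agents_embedding {A : Finset ℕ} (hA : ∀ x ∈ A, 1 ≤ x) :
    ∀ᶠ N in atTop, ∃ e₀ : A ↪ agents N, ∀ x, (e₀ x : ℕ) = x := by
  filter_upwards [eventually_ge_atTop (A.sup id)] with N hN
  refine ⟨⟨fun x => ⟨x, Finset.mem_Icc.2 ⟨hA x x.2, (Finset.le_sup (f := id) x.2).trans hN⟩⟩,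
    fun x y h => Subtype.ext (congrArg (fun z : agents N => (z : ℕ)) h)⟩, fun x => rfl⟩

/-- Convergence of the grand canonical product laws. -/
theorem IsRegularlyVarying.tendsto_integral_pi_gcMeasure {A : Type*} [Fintype A] {G : ℕ → ℝ}
    {ρ : ℝ} {φ : ℝ → ℝ} (hRV : IsRegularlyVarying G ρ φ) (hρ : 0 ≤ ρ) (hG : ∀ k, 0 < G k)
    {θ : ℝ} (hθ : 0 < θ) (hp : ∀ᶠ b in atTop, IsProbabilityMeasure (gcMeasure G θ b))
    (f : (A → ℝ) →ᵇ ℝ) :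
    Tendsto (fun b => ∫ ζ, f (fun i => (ζ i : ℝ) / b) ∂(Measure.pi fun _ : A => gcMeasure G θ b))
      atTop (𝓝 (∫ r, f r ∂(Measure.pi fun _ : A => gammaMeasure (ρ + 1) θ))) := by
  have hmeas : ∀ b : ℝ, Measurable fun k : ℕ => (k : ℝ) / b := fun b => measurable_of_countable _
  have : IsProbabilityMeasure (gammaMeasure (ρ + 1) θ) :=
    isProbabilityMeasure_gammaMeasure (by linarith) hθ
  have h := tendsto_integral_pi_of_forall_tendsto (A := A)
    (μs := fun b => (gcMeasure G θ b).map fun k : ℕ => (k : ℝ) / b)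
    (μ := gammaMeasure (ρ + 1) θ) (l := atTop)
    (by
      filter_upwards [hp] with b hb
      exact Measure.isProbabilityMeasure_map (hmeas b).aemeasurable)
    (fun f => by
      refine (hRV.tendsto_integral_gcMeasure hρ hG hθ f.continuous (K := ‖f‖) (j := 0)
        fun u _ => by simpa using f.norm_coe_le_norm u).congr fun b => ?_
      rw [integral_map (hmeas b).aemeasurable f.continuous.aestronglyMeasurable]) f
  refine h.congr' ?_
  filter_upwards [hp] with b hb
  have : IsProbabilityMeasure ((gcMeasure G θ b).map fun k : ℕ => (k : ℝ) / b) :=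
    Measure.isProbabilityMeasure_map (hmeas b).aemeasurable
  rw [← Measure.pi_map_pi fun _ => (hmeas b).aemeasurable,
    integral_map (measurable_of_countable _).aemeasurable f.continuous.aestronglyMeasurable]

/-- Four errors of size `ε / 4`: the cost of conditioning, the quadratic term in `t`, the grand
canonical limit at mean `T₀`, and the change from `T₀` to `T`. -/
theorem tendsto_canonicalMean {G : ℕ → ℝ} {ρ T : ℝ} {φ : ℝ → ℝ}
    (hRV : IsRegularlyVarying G ρ φ) (hρ : 0 ≤ ρ) (hG : ∀ k, 0 < G k) (hmono : Monotone G)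
    (hT : 0 < T) {L : ℕ → ℕ} {a : ℕ → ℝ} (ha : Tendsto a atTop atTop)
    (hLa : Tendsto (fun N : ℕ => (L N : ℝ) / ((N : ℝ) * a N)) atTop (𝓝 T))
    {A : Finset ℕ} (hA : ∀ x ∈ A, 1 ≤ x) (f : (A → ℝ) →ᵇ ℝ) :
    Tendsto (fun N => canonicalMean G (L N) fun η => f (scaledField N (a N) A η)) atTop
      (𝓝 (∫ r, f r ∂(Measure.pi fun _ : A => gammaMeasure (ρ + 1) ((ρ + 1) / T)))) := by
  have hρ1 : 0 < ρ + 1 := by linarith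
  set J : ℝ → ℝ := fun T' =>
    ∫ r, f r ∂(Measure.pi fun _ : A => gammaMeasure (ρ + 1) ((ρ + 1) / T')) with hJ
  have hJlim : Tendsto J (𝓝 T) (𝓝 (J T)) := by
    have hdiv : Tendsto (fun T' => (ρ + 1) / T') (𝓝 T) (𝓝 ((ρ + 1) / T)) :=
      tendsto_const_nhds.div tendsto_id hT.ne'
    have : IsProbabilityMeasure (gammaMeasure (ρ + 1) ((ρ + 1) / T)) :=
      isProbabilityMeasure_gammaMeasure hρ1 (by positivity)
    refine tendsto_integral_pi_of_forall_tendsto ?_ (fun f => ?_) f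
    · filter_upwards [eventually_gt_nhds hT] with T' hT'
      exact isProbabilityMeasure_gammaMeasure hρ1 (by positivity)
    · exact (tendsto_integral_gammaMeasure hρ (by positivity) f).comp hdiv
  rw [Metric.tendsto_nhds]
  intro ε hε
  set C := ‖f‖ + 1 with hC
  have hCpos : 0 < C := by positivity
  -- `t` is fixed before `T₀`, because the cost of conditioning is of order `(T - T₀) / t`.
  obtain ⟨t, ht, htC, htε⟩ : ∃ t, 0 < t ∧ 2 * C * t ≤ 1 ∧ 4 * C ^ 2 * t ≤ ε / 4 := by
    refine ⟨min (1 / (2 * C)) (ε / (16 * C ^ 2)), by positivity, ?_, ?_⟩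
    · calc _ ≤ 2 * C * (1 / (2 * C)) := by gcongr; exact min_le_left _ _
        _ = 1 := by field_simp
    · calc _ ≤ 4 * C ^ 2 * (ε / (16 * C ^ 2)) := by gcongr; exact min_le_right _ _
        _ = ε / 4 := by field_simp; norm_num
  have hcost : Tendsto (fun T' => 6 * (Fintype.card A + 1) * (T - T') * ((ρ + 1) / T') / t) (𝓝 T)
      (𝓝 0) := by
    have : Tendsto (fun T' => 6 * (Fintype.card A + 1) * (T - T') * ((ρ + 1) / T') / t) (𝓝 T)
        (𝓝 (6 * (Fintype.card A + 1) * (T - T) * ((ρ + 1) / T) / t)) :=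
      ((tendsto_const_nhds.mul (tendsto_const_nhds.sub tendsto_id)).mul
        (tendsto_const_nhds.div tendsto_id hT.ne')).div_const t
    simpa using this
  obtain ⟨T₀, hT₀, hT₀T, hcostT₀, hJT₀⟩ : ∃ T₀, 0 < T₀ ∧ T₀ < T ∧
      6 * (Fintype.card A + 1) * (T - T₀) * ((ρ + 1) / T₀) / t < ε / 4 ∧
      dist (J T₀) (J T) < ε / 4 := by
    -- `T₀` must approach `T` strictly from below: monotonicity of `Z` only compares `L` with
    -- smaller totals.
    have h := ((eventually_gt_nhds hT).and ((hcost.eventually_lt_const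
      (show (0 : ℝ) < ε / 4 by positivity)).and
      (Metric.tendsto_nhds.1 hJlim (ε / 4) (by positivity)))).filter_mono
      (nhdsWithin_le_nhds (s := Set.Iio T))
    obtain ⟨T₀, ⟨h1, h2, h3⟩, h4⟩ := (h.and self_mem_nhdsWithin).exists
    exact ⟨T₀, h1, h4, h2, h3⟩
  -- This rate gives the limiting Gamma law mean `T₀`.
  set θ := (ρ + 1) / T₀ with hθdef
  have hθ : 0 < θ := by positivity
  have hmean : ∫ u, u ∂(gammaMeasure (ρ + 1) θ) = T₀ := by
    rw [integral_id_gammaMeasure hρ hθ, hθdef]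
    field_simp
  have hint : ∀ᶠ b in atTop, IntegrableOn (gcDensity G θ b) (Set.Ioi 0) := by
    have := hRV.eventually_integrableOn hG hθ (h := fun _ => 1) (K := 1) (j := 0) (by simp)
    simpa using this
  have hint2 : ∀ᶠ b in atTop,
      IntegrableOn (fun u => ((⌊u * b⌋₊ : ℝ) / b) ^ 2 * gcDensity G θ b u) (Set.Ioi 0) :=
    hRV.eventually_integrableOn hG hθ (h := fun u => u ^ 2) (K := 1) (j := 2) fun u hu => by
      rw [abs_of_nonneg (by positivity), one_mul]
      gcongr
      linarith
  have hnorm : ∀ᶠ b in atTop, 0 < gcNorm G θ b := by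
    filter_upwards [hint, eventually_gt_atTop 0] with b hb hb0
    exact gcNorm_pos hG hmono hθ hb0 hb
  have hprob : ∀ᶠ b in atTop, IsProbabilityMeasure (gcMeasure G θ b) := by
    filter_upwards [hint, hnorm] with b hb hn
    exact isProbabilityMeasure_gcMeasure hG hn hb
  have hcmp := eventually_abs_canonicalMean_sub_integral_le (A := A) (C := C) hG hmono hθ
    (sub_pos.2 hT₀T) ht htC ha (by rwa [add_sub_cancel])
    (ν := gcMeasure G θ) (c := fun b => (b * gcNorm G θ b)⁻¹) hprob
    (by
      filter_upwards [hnorm, eventually_gt_atTop 0] with b hn hb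
      positivity)
    (by
      filter_upwards [eventually_gt_atTop 0] with b hb
      exact measureReal_gcMeasure_singleton hG hb)
    (by
      filter_upwards [hint, hnorm, eventually_gt_atTop 0] with b hi hn hb k
      have := mul_pow_le_mul_gcNorm hG hmono hθ hb hi k
      rw [measureReal_gcMeasure_singleton hG hb, mul_assoc, inv_mul_le_iff₀ (by positivity)]
      calc _ ≤ θ * gcNorm G θ b := this
        _ = _ := by field_simp)
    (by
      filter_upwards [hint2, eventually_gt_atTop 0] with b hi hb
      rw [memLp_two_iff_integrable_sq (measurable_of_countable _).aestronglyMeasurable]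
      refine integrable_gcMeasure hG θ b ((hi.const_mul (b ^ 2)).congr (ae_of_all _ fun u => ?_))
      field_simp)
    (by
      rw [← hmean]
      exact hRV.tendsto_integral_gcMeasure hρ hG hθ (h := fun u => u) continuous_id (K := 1)
        (j := 1) fun u hu => by
          rw [abs_of_nonneg hu]
          linarith)
    (hRV.tendsto_integral_gcMeasure hρ hG hθ (h := fun u => u ^ 2) (by fun_prop) (K := 1)
      (j := 2) fun u hu => by
        rw [abs_of_nonneg (by positivity), one_mul]
        gcongr
        linarith)
  have hgc := (hRV.tendsto_integral_pi_gcMeasure hρ hG hθ hprob f).comp ha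
  filter_upwards [hcmp, exists_agents_embedding hA,
    Metric.tendsto_nhds.1 hgc (ε / 4) (by positivity)] with N hcmp hemb hgc
  obtain ⟨e₀, he₀⟩ := hemb
  have h1 := hcmp e₀ (fun ζ => f fun i => (ζ i : ℝ) / a N) fun ζ =>
    (f.norm_coe_le_norm _).trans (by rw [hC]; linarith)
  have h2 : (fun η => f (scaledField N (a N) A η)) =
      fun ξ : agents N → ℕ => f fun i => ((ξ ∘ e₀) i : ℝ) / a N := by
    funext η
    rw [scaledField_eq e₀ he₀]
  rw [h2]
  simp only [Function.comp_apply] at hgc h1 ⊢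
  rw [← Real.dist_eq] at h1
  calc _ ≤ _ + _ + _ := dist_triangle4 _ _ (J T₀) _
    _ < (ε / 4 + ε / 4) + ε / 4 + ε / 4 := by
      refine add_lt_add (add_lt_add_of_le_of_lt (h1.trans ?_) hgc) hJT₀
      exact add_le_add hcostT₀.le htε
    _ = ε := by ring

theorem integral_stationaryMeasure {g : ℕ → ℝ} (hg : ∀ k, 0 ≤ g k) (N L : ℕ)
    (F : (agents N → ℕ) → ℝ) :
    ∫ η, F η ∂(stationaryMeasure g N L) = canonicalMean (cumWeight g) L F := by
  have hnn : ∀ ξ : agents N → ℕ, 0 ≤ configWeight g N ξ := fun ξ =>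
    Finset.prod_nonneg fun x _ => Finset.sum_nonneg fun j _ => hg j
  have hZ : 0 ≤ partitionFn g N L := Finset.sum_nonneg fun ξ _ => hnn ξ
  rw [stationaryMeasure, integral_finsetSum_measure fun ξ _ => ?_]
  · refine Finset.sum_congr rfl fun ξ _ => ?_
    rw [integral_smul_measure, integral_dirac, ENNReal.toReal_ofReal (div_nonneg (hnn ξ) hZ)]
    rfl
  · exact (integrable_dirac (by simp)).smul_measure ENNReal.ofReal_ne_top

theorem integral_reshufflingMeasure (N L : ℕ) (F : (agents N → ℕ) → ℝ) :
    ∫ η, F η ∂(reshufflingMeasure N L) = canonicalMean (fun _ => 1) L F := by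
  have hint : IntegrableOn F (configs (agents N) L : Set (agents N → ℕ)) Measure.count := by
    rw [← Set.biUnion_of_singleton (configs (agents N) L : Set (agents N → ℕ))]
    exact integrableOn_finset_iUnion.2 fun ξ _ => integrableOn_singleton (hx := by rw [Measure.count_singleton]; simp)
  rw [reshufflingMeasure, uniformOn, ProbabilityTheory.cond, integral_smul_measure,
    setIntegral_finset _ hint]
  simp [canonicalMean, canonicalZ, configs, Finset.mul_sum, measureReal_def, Measure.count_apply]

end Main

end MoneyExchange

theorem theorem1 (L : ℕ → ℕ) (a : ℕ → ℝ) (T : ℝ)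
    (hL : ∀ N, 1 ≤ N → 0 < L N) (hT : 0 < T)
    (ha : Tendsto a atTop atTop)
    (hLa : Tendsto (fun N : ℕ => (L N : ℝ) / ((N : ℝ) * a N)) atTop (𝓝 T)) :
    -- weight functions with power-law behaviour
    (∀ g : ℕ → ℝ, (∀ k, 0 ≤ g k) → 0 < g 0 →
      ∀ α c : ℝ, 0 < c →
        Tendsto (fun k : ℕ => g k / (k : ℝ) ^ α) atTop (𝓝 c) →
        ∀ A : Finset ℕ, (∀ x ∈ A, 1 ≤ x) →
        ∀ f : (A → ℝ) → ℝ, Continuous f → (∃ C, ∀ r, |f r| ≤ C) →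
          Tendsto
            (fun N : ℕ => ∫ η, f (MoneyExchange.scaledField N (a N) A η)
              ∂(MoneyExchange.stationaryMeasure g N (L N)))
            atTop
            (𝓝 (∫ r, f r ∂(Measure.pi fun _ : A => MoneyExchange.limitMarginal α T)))) ∧
    -- summable weight functions
    (∀ g : ℕ → ℝ, (∀ k, 0 ≤ g k) → 0 < g 0 → Summable g →
        ∀ A : Finset ℕ, (∀ x ∈ A, 1 ≤ x) →
        ∀ f : (A → ℝ) → ℝ, Continuous f → (∃ C, ∀ r, |f r| ≤ C) →
          Tendsto
            (fun N : ℕ => ∫ η, f (MoneyExchange.scaledField N (a N) A η)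
              ∂(MoneyExchange.stationaryMeasure g N (L N)))
            atTop
            (𝓝 (∫ r, f r ∂(Measure.pi fun _ : A => expMeasure (1 / T))))) ∧
    -- the uniform distribution
    (∀ A : Finset ℕ, (∀ x ∈ A, 1 ≤ x) →
        ∀ f : (A → ℝ) → ℝ, Continuous f → (∃ C, ∀ r, |f r| ≤ C) →
          Tendsto
            (fun N : ℕ => ∫ η, f (MoneyExchange.scaledField N (a N) A η)
              ∂(MoneyExchange.reshufflingMeasure N (L N)))
            atTop
            (𝓝 (∫ r, f r ∂(Measure.pi fun _ : A => expMeasure (1 / T))))) := by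
  have main : ∀ g : ℕ → ℝ, (∀ k, 0 ≤ g k) → 0 < g 0 → ∀ (ρ : ℝ) (φ : ℝ → ℝ), 0 ≤ ρ →
      MoneyExchange.IsRegularlyVarying (MoneyExchange.cumWeight g) ρ φ →
      ∀ A : Finset ℕ, (∀ x ∈ A, 1 ≤ x) →
      ∀ f : (A → ℝ) → ℝ, Continuous f → (∃ C, ∀ r, |f r| ≤ C) →
        Tendsto (fun N : ℕ => MoneyExchange.canonicalMean (MoneyExchange.cumWeight g) (L N)
          fun η => f (MoneyExchange.scaledField N (a N) A η)) atTop
          (𝓝 (∫ r, f r ∂(Measure.pi fun _ : A => gammaMeasure (ρ + 1) ((ρ + 1) / T)))) := by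
    rintro g hg hg0 ρ φ hρ hRV A hA f hf ⟨C, hC⟩
    exact MoneyExchange.tendsto_canonicalMean hRV hρ (MoneyExchange.cumWeight_pos hg hg0)
      (MoneyExchange.cumWeight_mono hg) hT ha hLa hA
      (BoundedContinuousFunction.ofNormedAddCommGroup f hf C hC)
  have main₀ : ∀ g : ℕ → ℝ, (∀ k, 0 ≤ g k) → 0 < g 0 → ∀ φ : ℝ → ℝ,
      MoneyExchange.IsRegularlyVarying (MoneyExchange.cumWeight g) 0 φ →
      ∀ A : Finset ℕ, (∀ x ∈ A, 1 ≤ x) →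
      ∀ f : (A → ℝ) → ℝ, Continuous f → (∃ C, ∀ r, |f r| ≤ C) →
        Tendsto (fun N : ℕ => MoneyExchange.canonicalMean (MoneyExchange.cumWeight g) (L N)
          fun η => f (MoneyExchange.scaledField N (a N) A η)) atTop
          (𝓝 (∫ r, f r ∂(Measure.pi fun _ : A => expMeasure (1 / T)))) := by
    intro g hg hg0 φ hRV A hA f hf hC
    simpa [expMeasure] using main g hg hg0 0 φ le_rfl hRV A hA f hf hC
  refine ⟨?_, ?_, ?_⟩
  · intro g hg hg0 α c hc hlim A hA f hf hC
    simp only [MoneyExchange.integral_stationaryMeasure hg, MoneyExchange.limitMarginal]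
    rcases lt_trichotomy α (-1) with hα | rfl | hα
    · rw [if_neg hα.not_gt]
      obtain ⟨φ, hφ⟩ := MoneyExchange.exists_isRegularlyVarying_of_summable hg hg0
        (MoneyExchange.summable_of_tendsto_div_rpow hα hlim)
      exact main₀ g hg hg0 φ hφ A hA f hf hC
    · rw [if_neg (lt_irrefl _)]
      obtain ⟨φ, hφ⟩ := MoneyExchange.exists_isRegularlyVarying_of_eq_neg_one hc hlim
      exact main₀ g hg hg0 φ hφ A hA f hf hC
    · rw [if_pos hα]
      obtain ⟨φ, hφ⟩ := MoneyExchange.exists_isRegularlyVarying_of_neg_one_lt hα hc hlim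
      have := main g hg hg0 (α + 1) φ (by linarith) hφ A hA f hf hC
      rwa [show α + 1 + 1 = α + 2 by ring] at this
  · intro g hg hg0 hs A hA f hf hC
    simp only [MoneyExchange.integral_stationaryMeasure hg]
    obtain ⟨φ, hφ⟩ := MoneyExchange.exists_isRegularlyVarying_of_summable hg hg0 hs
    exact main₀ g hg hg0 φ hφ A hA f hf hC
  · intro A hA f hf hC
    -- With `g` the indicator of 0 the partial sums are constantly 1, so the stationary law is
    -- uniform and the summable case applies.
    have hg : ∀ k, 0 ≤ (Pi.single 0 1 : ℕ → ℝ) k := fun k => by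
      by_cases h : k = 0 <;> simp [h]
    have hcum : MoneyExchange.cumWeight (Pi.single 0 1) = fun _ => 1 := by
      funext k
      simp [MoneyExchange.cumWeight, Pi.single_apply]
    have hs : Summable (Pi.single 0 1 : ℕ → ℝ) := (hasSum_pi_single 0 1).summable
    obtain ⟨φ, hφ⟩ := MoneyExchange.exists_isRegularlyVarying_of_summable hg (by simp) hs
    have := main₀ _ hg (by simp) φ hφ A hA f hf hC
    simpa only [hcum, ← MoneyExchange.integral_reshufflingMeasure] using this
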